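/- Let $n\ge 2$, $d>0$, and consider in $\mathbb{R}^n$ the system $\dot x=A_0x+b_0u$, $|u|\le d$, that is $\dot x_1=u$, $\dot x_k=x_{k-1}$ for $k=2,\dots,n$. Put $a_1=-\frac{n(n+1)}{2}$, $D_n=\mathrm{diag}\left(\frac{(-1)^{i-1}}{(i-1)!}\right)_{i=1}^n$ and $D(\Theta)=\mathrm{diag}\left(\Theta^{-\frac{2i-1}{2}}\right)_{i=1}^n$ for $\Theta>0$. Let $\widetilde P$ be the $(n-1)\times(n-1)$ matrix whose first column is $(-1,0,\dots,0)^*$ and whose entry in row $r$ and column $s\ge 2$ is $\frac{1}{(r+s)(r+s+1)}$. Let $d',d''\in\mathbb{R}^{n-1}$ be given by $d'_r=-\frac{1}{(n+r)(n+r+1)}$ for $1\le r\le n-1$, $d''_1=-\frac{3+a_1}{2\cdot 3}$, and $d''_r=-\frac{a_1}{(r+1)(r+2)}$ for $2\le r\le n-1$. Let $\Delta=\det\widetilde P$, and let $\Delta'_j$, $\Delta''_j$ be the determinants of the matrices obtained from $\widetilde P$ by replacing its $j$-th column by $d'$, $d''$ respectively. For a real number $a_n$ put $$\eta_j=\frac1\Delta\left(\Delta'_j\frac{(-1)^{n-1}}{(n-1)!}a_n+\Delta''_j\right),\qquad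 j=1,\dots,n-1.$$ Let $\xi_0$ be a root of the equation $\det R(\xi_0)=0$, where $R(\xi)$ is the $n\times n$ Hilbert matrix $\left(\frac1{i+j-1}\right)_{i,j=1}^n$ with its $(1,1)$ entry replaced by $\left(1+\frac1n\right)\xi+\frac12-\frac1{2n}$. Let real numbers $c_{2n-2}$ and $a_n$ satisfy $$c_{2n-2}>0,\qquad \eta_1>\max\left\{\xi_0,\ \left(\tfrac12+\tfrac1{2n}\right)\xi_0+\tfrac14-\tfrac1{4n}\right\}.$$ Let $C$ be $(2n-1)\,2n\,c_{2n-2}$ times the $n\times n$ matrix with $(1,1)$ entry $\eta_1$ and all other entries $\frac{1}{(i+j-1)(i+j)}$. Let $a\in\mathbb{R}^n$ be the vector with first coordinate $a_1$, last coordinate $a_n$, and coordinates $a_k=(-1)^{k-1}(k-1)!\,\eta_k$ for $1<k<n$. Let $F=D_n^{-1}C^{-1}D_n^{-1}$, $F^{-1}=D_nCD_n$, and $$0<a_0\le\frac{d^2}{2(F^{-1}a,a)}.$$ Then for every $x\ne0$ the equation $2a_0\Theta=(D(\Theta)FD(\Theta)x,x)$ has exactly one solution $\Theta=\Theta(x)>0$.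 With $\Theta(0)=0$, the function $\Theta$ is continuous on $\mathbb{R}^n$ and continuously differentiable on $\mathbb{R}^n\setminus\{0\}$. The feedback $$u(x)=\sum_{k=1}^n\frac{a_kx_k}{\Theta^k(x)}\quad(x\ne0),\qquad u(0)=0,$$ satisfies $|u(x)|\le d$ for all $x\in\mathbb{R}^n$. The derivative of $\Theta$ by virtue of the system $\dot x=A_0x+b_0u(x)$ equals $-1$ at every $x\ne0$. Moreover, $u$ steers every $x_0\in\mathbb{R}^n$ to the origin in time exactly $\Theta(x_0)$, in the following sense. Call a continuous function $x:[0,T]\to\mathbb{R}^n$ with $x(0)=x_0$ a trajectory from $x_0$ on $[0,T]$ if it satisfies $\dot x=A_0x+b_0u(x)$ at every time in $[0,T)$. Then a trajectory from $x_0$ on $[0,\Theta(x_0)]$ exists. For every trajectory from $x_0$ on an interval $[0,T]$ and every $t\in[0,T]$, one has $\Theta(x(t))=\max\{\Theta(x_0)-t,\,0\}$, and $x(t)=0$ if and only if $t\ge\Theta(x_0)$. -/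

import Mathlib

open scoped Matrix Nat

noncomputable section

namespace ChainSynthesis

/-! Vectors of `ℝⁿ` are functions `Fin n → ℝ`; the coordinate with index `k = 1, …, n` of the usual
notation is the one with `i : Fin n`, `k = i + 1`. The scalar product `(x, y)` is `x ⬝ᵥ y`. -/

/-- The matrix of the chain of integrators: ones on the first subdiagonal, zeros elsewhere. -/
def A0 (n : ℕ) : Matrix (Fin n) (Fin n) ℝ :=
  Matrix.of fun i j => if (i : ℕ) = (j : ℕ) + 1 then 1 else 0

/-- The vector `(1, 0, …, 0)`. -/
def b0 (n : ℕ) : Fin n → ℝ := fun i => if (i : ℕ) = 0 then 1 else 0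

/-- `D(θ) = diag (θ ^ (-(2k - 1)/2))`, `k = 1, …, n` (used for `θ > 0`). -/
def D (n : ℕ) (θ : ℝ) : Matrix (Fin n) (Fin n) ℝ :=
  Matrix.diagonal fun i => θ ^ (-((2 * ((i : ℝ) + 1) - 1) / 2))

/-- `D_n = diag ((-1)^(k-1) / (k-1)!)`, `k = 1, …, n`. -/
def Dn (n : ℕ) : Matrix (Fin n) (Fin n) ℝ :=
  Matrix.diagonal fun i => (-1) ^ (i : ℕ) / ((i : ℕ)! : ℝ)

/-- The number `a₁ = -n(n+1)/2`. -/
def a1 (n : ℕ) : ℝ := -((n : ℝ) * ((n : ℝ) + 1) / 2)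

/-- The `(n-1) × (n-1)` matrix with first column `(-1, 0, …, 0)` and, for `c ≥ 2`, entry
`1 / ((r + c) (r + c + 1))` in row `r` and column `c` (rows and columns counted from `1`). -/
def Ptilde (n : ℕ) : Matrix (Fin (n - 1)) (Fin (n - 1)) ℝ :=
  Matrix.of fun r c =>
    if (c : ℕ) = 0 then (if (r : ℕ) = 0 then -1 else 0)
    else 1 / (((r : ℝ) + c + 2) * ((r : ℝ) + c + 3))

/-- The vector `d'` with coordinates `-1 / ((n + r) (n + r + 1))`, `r = 1, …, n - 1`. -/
def d' (n : ℕ) : Fin (n - 1) → ℝ :=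
  fun r => -(1 / (((n : ℝ) + r + 1) * ((n : ℝ) + r + 2)))

/-- The vector `d''` with coordinates `-(3 + a₁) / (2 · 3)` for `r = 1` and
`-a₁ / ((r + 1) (r + 2))` for `r = 2, …, n - 1`. -/
def d'' (n : ℕ) : Fin (n - 1) → ℝ :=
  fun r =>
    if (r : ℕ) = 0 then -((3 + a1 n) / (2 * 3))
    else -(a1 n / (((r : ℝ) + 2) * ((r : ℝ) + 3)))

/-- The determinant `Δ`. -/
def Δ (n : ℕ) : ℝ := (Ptilde n).det

/-- The determinant of the matrix obtained from `Ptilde n` by replacing its `j`-th column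
(`j = 1, …, n - 1`, counted from `1`) by the vector `v`. -/
def colDet (n : ℕ) (v : Fin (n - 1) → ℝ) (j : ℕ) : ℝ :=
  (Matrix.of fun r c : Fin (n - 1) => if (c : ℕ) + 1 = j then v r else Ptilde n r c).det

/-- `(1/Δ) (Δ'_j (-1)^(n-1)/(n-1)! aₙ + Δ''_j)`, for `j = 1, …, n - 1`, where `Δ'_j` and `Δ''_j` are
the determinants with `d'` and `d''` in place of the `j`-th column. -/
def η (n : ℕ) (an : ℝ) (j : ℕ) : ℝ :=
  1 / Δ n * (colDet n (d' n) j * ((-1) ^ (n - 1) / ((n - 1)! : ℝ)) * an + colDet n (d'' n) j)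

/-- The matrix `C` with parameters `c = c_{2n-2}` and `aₙ`. -/
def C (n : ℕ) (c an : ℝ) : Matrix (Fin n) (Fin n) ℝ :=
  ((2 * (n : ℝ) - 1) * (2 * (n : ℝ)) * c) •
    Matrix.of fun i j : Fin n =>
      if (i : ℕ) = 0 ∧ (j : ℕ) = 0 then η n an 1
      else 1 / (((i : ℝ) + j + 1) * ((i : ℝ) + j + 2))

/-- The vector `a`: first coordinate `-n(n+1)/2`, last coordinate `aₙ`, and
`a_k = (-1)^(k-1) (k-1)! (1/Δ) (Δ'_k (-1)^(n-1)/(n-1)! aₙ + Δ''_k)` for `1 < k < n`. -/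
def aVec (n : ℕ) (an : ℝ) : Fin n → ℝ :=
  fun i =>
    if (i : ℕ) = 0 then a1 n
    else if (i : ℕ) = n - 1 then an
    else (-1) ^ (i : ℕ) * ((i : ℕ)! : ℝ) * η n an ((i : ℕ) + 1)

/-- The Hilbert matrix with upper left entry replaced by `(1 + 1/n) ξ + 1/2 - 1/(2n)`. -/
def rootMatrix (n : ℕ) (ξ : ℝ) : Matrix (Fin n) (Fin n) ℝ :=
  Matrix.of fun i j =>
    if (i : ℕ) = 0 ∧ (j : ℕ) = 0 then (1 + 1 / (n : ℝ)) * ξ + 1 / 2 - 1 / (2 * (n : ℝ))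
    else 1 / ((i : ℝ) + j + 1)

/-- `F⁻¹ = D_n C D_n`. -/
def Finv (n : ℕ) (c an : ℝ) : Matrix (Fin n) (Fin n) ℝ := Dn n * C n c an * Dn n

/-- `F = D_n⁻¹ C⁻¹ D_n⁻¹`. -/
def F (n : ℕ) (c an : ℝ) : Matrix (Fin n) (Fin n) ℝ := (Dn n)⁻¹ * (C n c an)⁻¹ * (Dn n)⁻¹

/-- The equation `2 a₀ θ = (D(θ) F D(θ) x, x)`. -/
def ThetaEq {n : ℕ} (F : Matrix (Fin n) (Fin n) ℝ) (a₀ : ℝ) (x : Fin n → ℝ) (θ : ℝ) : Prop :=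
  2 * a₀ * θ = ((D n θ * F * D n θ) *ᵥ x) ⬝ᵥ x

/-- `Θ` vanishes at `0`, and at every `x ≠ 0` its value is a positive solution of the equation. -/
def IsControllabilityFunction {n : ℕ} (F : Matrix (Fin n) (Fin n) ℝ) (a₀ : ℝ)
    (Θ : (Fin n → ℝ) → ℝ) : Prop :=
  Θ 0 = 0 ∧ ∀ x, x ≠ 0 → 0 < Θ x ∧ ThetaEq F a₀ x (Θ x)

/-- The feedback `u(x) = ∑ a_k x_k / Θ(x)^k` for `x ≠ 0`, and `u(0) = 0`. -/
def feedback {n : ℕ} (a : Fin n → ℝ) (Θ : (Fin n → ℝ) → ℝ) (x : Fin n → ℝ) : ℝ :=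
  if x = 0 then 0 else ∑ i : Fin n, a i * x i / Θ x ^ ((i : ℕ) + 1)

/-- The right-hand side `A₀ x + b₀ u(x)` of the closed-loop system. -/
def closedLoop {n : ℕ} (u : (Fin n → ℝ) → ℝ) (x : Fin n → ℝ) : Fin n → ℝ :=
  A0 n *ᵥ x + u x • b0 n

/-- `x` is a trajectory on `[0, T]` of `x' = A₀ x + b₀ u(x)` from `x₀`: it is continuous on `[0, T]`
and satisfies the equation at every time in `[0, T)` (one-sided derivative at time `0`). At the final
time no derivative is asked for, since `u` need not have a limit at the origin. -/
structure IsTrajectory {n : ℕ} (u : (Fin n → ℝ) → ℝ) (x₀ : Fin n → ℝ) (T : ℝ)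
    (x : ℝ → Fin n → ℝ) : Prop where
  init : x 0 = x₀
  cont : ContinuousOn x (Set.Icc 0 T)
  ode : ∀ t ∈ Set.Ico 0 T, HasDerivWithinAt x (closedLoop u (x t)) (Set.Icc 0 T) t

end ChainSynthesis

end

open ChainSynthesis

open scoped Matrix Nat
open ChainSynthesis

/-! Put `z = (x_k / Θ ^ k)_k`, `N = diag(1, …, n)` and `G = F⁻¹`. Since `D(Θ) = Θ ^ (1/2) diag(Θ ^
(-k))`, the equation for `Θ` says that `z` lies on the ellipsoid `(F z, z) = 2 a₀`, and the control
is `(a, z)`. Everything follows from three facts collected in `IsAdmissible`: `F` is positive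
definite, `F N + N F` is positive definite, and `(F z, (A₀ + b₀ a*) z) = -(F z, N z)`. The second
fact makes the form strictly increasing in `1/Θ`, which gives uniqueness and, by the implicit
function theorem, smoothness. Differentiating the ellipsoid equation along the system, the third
fact gives `(F z, N z) (Θ' + 1) = 0`, hence `Θ' = -1`. Cauchy–Schwarz `(a, z)² ≤ (G a, a) (F z, z)`
bounds the control. In logarithmic time `z` obeys a linear equation that preserves the ellipsoid,
which yields the trajectories. To verify the three facts one works with `G`. Up to scaling it is the
matrix `1 / ((i+j-1)(i+j))` with a changed corner, and multiplication of the entries by `i + j`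
turns it into a Hilbert matrix with a changed corner, which represents `N G + G N`. For each, the
first column of the inverse of the unchanged matrix gives the exact corner value where definiteness
is lost; the two lower bounds on `η₁` are these values (`root_eq`, `withCorner_jacobiMatrix_pos`,
`withCorner_hilbertMatrix_pos`). The Lyapunov identity (`lyapunov_Finv`) reduces to a linear system
for `a`, solved by Cramer's rule except for its first row, which the choice of `a₁` guarantees. -/

namespace ChainSynthesis

/-! ### Finite differences and first columns of inverse Hilbert-type matrices. -/

open Polynomial Finset in
theorem sum_alternating_choose_eval_eq_zero {m : ℕ} {P : ℝ[X]} (hP : P.natDegree < m) :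
    ∑ k ∈ range (m + 1), (-1 : ℝ) ^ k * m.choose k * P.eval (k : ℝ) = 0 := by
  have h := congrFun (Polynomial.fwdDiff_iter_eq_zero_of_degree_lt hP) 0
  rw [fwdDiff_iter_eq_sum_shift] at h
  have h2 : ∑ k ∈ range (m + 1), (-1 : ℝ) ^ k * m.choose k * P.eval (k : ℝ)
      = (-1) ^ m * ∑ k ∈ range (m + 1),
        ((-1 : ℤ) ^ (m - k) * (m.choose k : ℤ)) • P.eval (0 + k • (1 : ℝ)) := by
    rw [mul_sum]
    refine sum_congr rfl fun k hk => ?_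
    have hk' : k ≤ m := by simpa [Nat.lt_succ_iff] using hk
    obtain ⟨l, rfl⟩ := Nat.exists_eq_add_of_le hk'
    have : (-1 : ℝ) ^ l * (-1) ^ l = 1 := by rw [← mul_pow]; simp
    simp only [nsmul_eq_mul, mul_one, zero_add, zsmul_eq_mul, add_tsub_cancel_left, pow_add]
    push_cast
    linear_combination
      (-((-1 : ℝ) ^ k * ((k + l).choose k) * P.eval (k : ℝ))) * this
  rw [h2, h]
  simp

-- Absorption, `C(m,k) / (k+1) = C(m+1,k+1) / (m+1)`, turns the sum into an `(m+1)`-st difference of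
-- `P` with its term at `0` missing.
open Polynomial Finset in
theorem sum_alternating_choose_div_eval {m : ℕ} {P : ℝ[X]} (hP : P.natDegree ≤ m) :
    ∑ k ∈ range (m + 1), (-1 : ℝ) ^ k * m.choose k * (P.eval ((k : ℝ) + 1) / ((k : ℝ) + 1))
      = P.eval 0 / (m + 1) := by
  have h := sum_alternating_choose_eval_eq_zero (Nat.lt_succ_of_le hP)
  rw [sum_range_succ'] at h
  have h2 : ∑ k ∈ range (m + 1), (-1 : ℝ) ^ (k + 1) * (m + 1).choose (k + 1)
        * P.eval ((k + 1 : ℕ) : ℝ)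
      = -(m + 1) * ∑ k ∈ range (m + 1),
        (-1 : ℝ) ^ k * m.choose k * (P.eval ((k : ℝ) + 1) / ((k : ℝ) + 1)) := by
    rw [mul_sum]
    refine sum_congr rfl fun k _ => ?_
    have hc : ((m : ℝ) + 1) * m.choose k = (m + 1).choose (k + 1) * ((k : ℝ) + 1) := by
      exact_mod_cast Nat.add_one_mul_choose_eq m k
    have hk : (k : ℝ) + 1 ≠ 0 := by positivity
    push_cast
    field_simp
    rw [pow_succ]
    linear_combination (-1 : ℝ) ^ k * P.eval ((k : ℝ) + 1) * hc
  rw [h2] at h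
  simp only [pow_zero, Nat.choose_zero_right, Nat.cast_one, Nat.cast_zero, one_mul] at h
  have hm : (m : ℝ) + 1 ≠ 0 := by positivity
  rw [eq_div_iff hm]
  linear_combination -h

open Polynomial Finset in
theorem natDegree_prod_X_add_C_le (s : Finset ℕ) (f : ℕ → ℝ) :
    (∏ l ∈ s, (X + Polynomial.C (f l))).natDegree = #s := by
  rw [natDegree_prod_of_monic _ _ fun l _ => monic_X_add_C (f l)]
  simp

/-- Up to a scalar, the first column of the inverse of the Hilbert matrix of order `m + 1`. -/
def hilbertCol (m : ℕ) (j : ℕ) : ℝ :=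
  (-1) ^ j * m.choose j * ∏ l ∈ Finset.range m, ((j : ℝ) + (l + 2))

/-- Up to a scalar, the first column of the inverse of the matrix `1 / ((i + j + 1) (i + j + 2))`
of order `m + 1`, `i, j = 0, …, m`. -/
def jacobiCol (m : ℕ) (j : ℕ) : ℝ :=
  (-1) ^ j * m.choose j * ∏ l ∈ Finset.range (m + 1), ((j : ℝ) + (l + 2))

theorem prod_range_add_two (m : ℕ) : ∏ l ∈ Finset.range m, ((l : ℝ) + 2) = ((m + 1)! : ℝ) := by
  induction m with
  | zero => simp
  | succ k ih => rw [Finset.prod_range_succ, ih, Nat.factorial_succ (k + 1)]; push_cast; ring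

theorem two_mul_prod_range_add_three (m : ℕ) :
    2 * ∏ l ∈ Finset.range m, (1 + ((l : ℝ) + 2)) = ((m + 2)! : ℝ) := by
  induction m with
  | zero => simp
  | succ k ih =>
    rw [Finset.prod_range_succ, ← mul_assoc, ih, Nat.factorial_succ (k + 2)]; push_cast; ring

theorem hilbertCol_zero (m : ℕ) : hilbertCol m 0 = ((m + 1)! : ℝ) := by
  simp [hilbertCol, prod_range_add_two]

theorem jacobiCol_zero (m : ℕ) : jacobiCol m 0 = ((m + 2)! : ℝ) := by
  simp [jacobiCol, prod_range_add_two]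

theorem jacobiCol_one (m : ℕ) : jacobiCol m 1 = -(m * ((m + 3)! : ℝ) / 2) := by
  simp only [jacobiCol, pow_one, Nat.choose_one_right, Nat.cast_one]
  linear_combination (-(m : ℝ) / 2) * two_mul_prod_range_add_three (m + 1)

-- The denominator cancels the factor with `l = i - 1`; what is left is an `m`-th difference of a
-- polynomial of degree `m - 1`. In row `0` nothing cancels, and the value of the remaining
-- polynomial at `0` survives.
open Polynomial Finset in
theorem hilbertCol_row {m i : ℕ} (hi : 1 ≤ i) (him : i ≤ m) :
    ∑ j ∈ range (m + 1), 1 / ((i : ℝ) + j + 1) * hilbertCol m j = 0 := by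
  have hmem : i - 1 ∈ range m := by simp; omega
  set P : ℝ[X] := ∏ l ∈ (range m).erase (i - 1), (X + Polynomial.C ((l : ℝ) + 2))
  have hP : P.natDegree < m := by
    rw [natDegree_prod_X_add_C_le, card_erase_of_mem hmem, card_range]; omega
  rw [← sum_alternating_choose_eval_eq_zero hP]
  refine sum_congr rfl fun j _ => ?_
  have hi1 : ((i - 1 : ℕ) : ℝ) = i - 1 := by push_cast [hi]; ring
  have : (i : ℝ) + j + 1 ≠ 0 := by positivity
  simp only [P, hilbertCol, eval_prod, eval_add, eval_X, eval_C]
  rw [← mul_prod_erase _ _ hmem, hi1]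
  field_simp
  ring

open Polynomial Finset in
theorem hilbertCol_row_zero (m : ℕ) :
    ∑ j ∈ range (m + 1), 1 / ((j : ℝ) + 1) * hilbertCol m j = (m ! : ℝ) / (m + 1) := by
  set P : ℝ[X] := ∏ l ∈ range m, (X + Polynomial.C ((l : ℝ) + 1))
  have hP : P.natDegree ≤ m := by
    rw [natDegree_prod_X_add_C_le, card_range]
  have h0 : P.eval 0 = (m ! : ℝ) := by
    simp only [P, eval_prod, eval_add, eval_X, eval_C, zero_add]
    exact_mod_cast prod_range_add_one_eq_factorial m
  rw [← h0, ← sum_alternating_choose_div_eval hP]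
  refine sum_congr rfl fun j _ => ?_
  simp only [P, hilbertCol, eval_prod, eval_add, eval_X, eval_C]
  have : ∏ l ∈ range m, ((j : ℝ) + (l + 2)) = ∏ l ∈ range m, ((j : ℝ) + 1 + (l + 1)) :=
    prod_congr rfl fun l _ => by ring
  rw [this]
  ring

-- The extra factor in `jacobiCol` is there so that both factors of the denominator cancel, those
-- with `l = i - 1` and `l = i`.
open Polynomial Finset in
theorem jacobiCol_row {m i : ℕ} (hi : 1 ≤ i) (him : i ≤ m) :
    ∑ j ∈ range (m + 1), 1 / (((i : ℝ) + j + 1) * ((i : ℝ) + j + 2)) * jacobiCol m j = 0 := by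
  have hmem : i ∈ range (m + 1) := by simp; omega
  have hmem' : i - 1 ∈ (range (m + 1)).erase i := by simp; omega
  set P : ℝ[X] := ∏ l ∈ ((range (m + 1)).erase i).erase (i - 1), (X + Polynomial.C ((l : ℝ) + 2))
  have hP : P.natDegree < m := by
    rw [natDegree_prod_X_add_C_le, card_erase_of_mem hmem', card_erase_of_mem hmem,
      card_range]; omega
  rw [← sum_alternating_choose_eval_eq_zero hP]
  refine sum_congr rfl fun j _ => ?_
  have hi1 : ((i - 1 : ℕ) : ℝ) = i - 1 := by push_cast [hi]; ring
  have : (i : ℝ) + j + 1 ≠ 0 := by positivity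
  have : (i : ℝ) + j + 2 ≠ 0 := by positivity
  simp only [P, jacobiCol, eval_prod, eval_add, eval_X, eval_C]
  rw [← mul_prod_erase _ _ hmem, ← mul_prod_erase _ _ hmem', hi1]
  field_simp
  ring

open Polynomial Finset in
theorem jacobiCol_row_zero (m : ℕ) :
    ∑ j ∈ range (m + 1), 1 / (((j : ℝ) + 1) * ((j : ℝ) + 2)) * jacobiCol m j = (m ! : ℝ) := by
  set P : ℝ[X] := ∏ l ∈ range m, (X + Polynomial.C ((l : ℝ) + 2))
  have hP : P.natDegree ≤ m := by
    rw [natDegree_prod_X_add_C_le, card_range]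
  have h0 : P.eval 0 = ((m + 1)! : ℝ) := by
    simp only [P, eval_prod, eval_add, eval_X, eval_C, zero_add]
    exact prod_range_add_two m
  have h1 : (m ! : ℝ) = P.eval 0 / (m + 1) := by
    rw [h0, Nat.factorial_succ]; push_cast; field_simp
  rw [h1, ← sum_alternating_choose_div_eval hP]
  refine sum_congr rfl fun j _ => ?_
  simp only [P, jacobiCol, eval_prod, eval_add, eval_X, eval_C]
  rw [prod_range_succ']
  have : ∏ l ∈ range m, ((j : ℝ) + (((l + 1 : ℕ) : ℝ) + 2))
      = ∏ l ∈ range m, ((j : ℝ) + 1 + (l + 2)) :=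
    prod_congr rfl fun l _ => by push_cast; ring
  rw [this]
  have : (j : ℝ) + 1 ≠ 0 := by positivity
  have : (j : ℝ) + 2 ≠ 0 := by positivity
  push_cast
  field_simp
  ring

/-! ### Positivity of moment matrices. -/

/-- The Hankel matrix of the moments of a positive weight on `(0, 1)` is positive definite. -/
theorem hankel_moment_pos {n : ℕ} {ω : ℝ → ℝ} (hω : Continuous ω)
    (hpos : ∀ t ∈ Set.Ioo (0 : ℝ) 1, 0 < ω t) {μ : ℕ → ℝ}
    (hμ : ∀ k, μ k = ∫ t in (0 : ℝ)..1, t ^ k * ω t) {x : Fin n → ℝ} (hx : x ≠ 0) :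
    0 < x ⬝ᵥ (Matrix.of fun i j : Fin n => μ (i + j)) *ᵥ x := by
  -- With `x` as the coefficients of `p`, the quadratic form is the integral of `p² ω`.
  set p : Polynomial ℝ := ∑ i : Fin n, Polynomial.monomial (i : ℕ) (x i) with hp
  have hcoeff : ∀ i : Fin n, p.coeff i = x i := fun i => by
    simp [hp, Polynomial.coeff_monomial, Fin.val_inj]
  have hp0 : p ≠ 0 := fun h => hx (funext fun i => by rw [← hcoeff, h]; simp)
  have heval : ∀ t, p.eval t = ∑ i : Fin n, x i * t ^ (i : ℕ) := fun t => by
    simp [hp, Polynomial.eval_finsetSum]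
  have hint : x ⬝ᵥ (Matrix.of fun i j : Fin n => μ (i + j)) *ᵥ x
      = ∫ t in (0 : ℝ)..1, p.eval t ^ 2 * ω t := by
    have h1 : ∀ t, p.eval t ^ 2 * ω t
        = ∑ i : Fin n, ∑ j : Fin n, x i * x j * (t ^ ((i : ℕ) + j) * ω t) := fun t => by
      rw [heval, sq, Finset.sum_mul_sum, Finset.sum_mul]
      refine Finset.sum_congr rfl fun i _ => ?_
      rw [Finset.sum_mul]
      refine Finset.sum_congr rfl fun j _ => ?_
      rw [pow_add]; ring
    simp only [h1]
    rw [intervalIntegral.integral_finsetSum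
      fun i _ => Continuous.intervalIntegrable (by fun_prop) _ _]
    simp only [dotProduct, Matrix.mulVec, Matrix.of_apply, Finset.mul_sum]
    refine Finset.sum_congr rfl fun i _ => ?_
    rw [intervalIntegral.integral_finsetSum
      fun i _ => Continuous.intervalIntegrable (by fun_prop) _ _]
    refine Finset.sum_congr rfl fun j _ => ?_
    rw [intervalIntegral.integral_const_mul, hμ]
    ring
  rw [hint]
  have hcont : Continuous fun t => p.eval t ^ 2 * ω t := by
    have := p.continuous
    fun_prop
  obtain ⟨t, ht, hpt⟩ : ∃ t ∈ Set.Ioo (0 : ℝ) 1, p.eval t ≠ 0 := by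
    by_contra! h
    exact hp0 (Polynomial.eq_zero_of_infinite_isRoot p
      ((Set.Ioo_infinite (zero_lt_one' ℝ)).mono fun t ht => h t ht))
  refine intervalIntegral.integral_pos zero_lt_one hcont.continuousOn (fun s hs => ?_)
    ⟨t, ⟨ht.1.le, ht.2.le⟩, by have := hpos t ht; positivity⟩
  have hcl : ∀ s ∈ Set.Icc (0 : ℝ) 1, 0 ≤ ω s := by
    rw [← closure_Ioo (zero_ne_one' ℝ)]
    exact fun s hs => closure_minimal (s := Set.Ioo (0 : ℝ) 1) (t := {s | 0 ≤ ω s})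
      (fun s hs => (hpos s hs).le) (isClosed_le continuous_const hω) hs
  exact mul_nonneg (sq_nonneg _) (hcl s ⟨hs.1.le, hs.2⟩)

theorem hilbert_pos {n : ℕ} {x : Fin n → ℝ} (hx : x ≠ 0) :
    0 < x ⬝ᵥ (Matrix.of fun i j : Fin n => 1 / ((i : ℝ) + j + 1)) *ᵥ x := by
  have := hankel_moment_pos (ω := fun _ => 1) continuous_const (fun _ _ => one_pos)
    (μ := fun k => 1 / ((k : ℝ) + 1)) (fun k => by simp) hx
  simpa using this

theorem jacobi_pos {n : ℕ} {x : Fin n → ℝ} (hx : x ≠ 0) :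
    0 < x ⬝ᵥ (Matrix.of fun i j : Fin n => 1 / (((i : ℝ) + j + 1) * ((i : ℝ) + j + 2))) *ᵥ x := by
  have := hankel_moment_pos (ω := fun t => 1 - t) (by fun_prop) (fun t ht => by linarith [ht.2])
    (μ := fun k => 1 / (((k : ℝ) + 1) * ((k : ℝ) + 2))) (fun k => by
      simp only [mul_sub, mul_one, ← pow_succ]
      rw [intervalIntegral.integral_sub (by simp) (by simp), integral_pow, integral_pow]
      have : (k : ℝ) + 1 ≠ 0 := by positivity
      have : (k : ℝ) + 2 ≠ 0 := by positivity
      push_cast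
      rw [show (k : ℝ) + 1 + 1 = k + 2 by ring]
      field_simp
      simp
      ring) hx
  simpa using this

theorem shifted_jacobi_pos {n : ℕ} {x : Fin n → ℝ} (hx : x ≠ 0) :
    0 < x ⬝ᵥ (Matrix.of fun i j : Fin n => 1 / (((i : ℝ) + j + 2) * ((i : ℝ) + j + 3))) *ᵥ x := by
  have := hankel_moment_pos (ω := fun t => t * (1 - t)) (by fun_prop)
    (fun t ht => mul_pos ht.1 (by linarith [ht.2]))
    (μ := fun k => 1 / (((k : ℝ) + 2) * ((k : ℝ) + 3))) (fun k => by
      simp only [mul_sub, mul_one, ← mul_assoc, ← pow_succ]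
      rw [intervalIntegral.integral_sub (by simp) (by simp), integral_pow, integral_pow]
      have : (k : ℝ) + 2 ≠ 0 := by positivity
      have : (k : ℝ) + 3 ≠ 0 := by positivity
      push_cast
      rw [show (k : ℝ) + 1 + 1 + 1 = k + 3 by ring, show (k : ℝ) + 1 + 1 = k + 2 by ring]
      field_simp
      simp
      ring) hx
  simpa using this

/-! ### Changing the corner entry of a positive definite matrix. -/

/-- Subtracting from `x` the multiple of `v` that kills coordinate `0` leaves a vector
`M`-orthogonal to `v`, so the form splits and the corner term affects only the component along `v`.
-/
theorem quadForm_add_corner_pos {m : ℕ} {M : Matrix (Fin (m + 1)) (Fin (m + 1)) ℝ}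
    (hsymm : Mᵀ = M) (hM : ∀ x, x ≠ 0 → 0 < x ⬝ᵥ M *ᵥ x) {v : Fin (m + 1) → ℝ} {κ t : ℝ}
    (hv : M *ᵥ v = Pi.single 0 κ) (hv0 : 0 < v 0) (ht : 0 < t * v 0 + κ)
    {x : Fin (m + 1) → ℝ} (hx : x ≠ 0) : 0 < x ⬝ᵥ M *ᵥ x + t * x 0 ^ 2 := by
  set r := x 0 / v 0 with hr
  set y := x - r • v with hy
  have hxy : x = y + r • v := by simp [hy]
  have hy0 : y 0 = 0 := by simp [hy, hr, hv0.ne']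
  have hx0 : x 0 = r * v 0 := by simp [hr, hv0.ne']
  have hvMy : v ⬝ᵥ M *ᵥ y = 0 := by
    rw [Matrix.dotProduct_mulVec, ← Matrix.mulVec_transpose, hsymm, hv]
    simp [hy0]
  have hexp : x ⬝ᵥ M *ᵥ x = y ⬝ᵥ M *ᵥ y + r ^ 2 * (v 0 * κ) := by
    conv_lhs => rw [hxy]
    simp only [Matrix.mulVec_add, Matrix.mulVec_smul, dotProduct_add, add_dotProduct,
      smul_dotProduct, dotProduct_smul, hvMy, hv, dotProduct_single, Pi.add_apply,
      Pi.smul_apply, hy0, smul_eq_mul]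
    ring
  have hsum : x ⬝ᵥ M *ᵥ x + t * x 0 ^ 2
      = y ⬝ᵥ M *ᵥ y + r ^ 2 * v 0 * (t * v 0 + κ) := by rw [hexp, hx0]; ring
  rw [hsum]
  by_cases hy' : y = 0
  · have : r ≠ 0 := fun h => hx (by rw [hxy, hy', h]; simp)
    rw [hy']
    simp only [zero_dotProduct, zero_add]
    positivity
  · have := hM y hy'
    have : 0 ≤ r ^ 2 * v 0 * (t * v 0 + κ) := by positivity
    linarith

/-- Pairing a kernel vector `x` of `M'` with `v` gives `(t * v 0 + κ) * x 0 = 0`; pairing it with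
itself excludes `x 0 = 0`. -/
theorem corner_eq_of_det_eq_zero {m : ℕ} {M M' : Matrix (Fin (m + 1)) (Fin (m + 1)) ℝ}
    (hsymm : Mᵀ = M) (hM : ∀ x, x ≠ 0 → 0 < x ⬝ᵥ M *ᵥ x) {v : Fin (m + 1) → ℝ} {κ t : ℝ}
    (hv : M *ᵥ v = Pi.single 0 κ) (hM' : ∀ x, M' *ᵥ x = M *ᵥ x + Pi.single 0 (t * x 0))
    (hdet : M'.det = 0) : t * v 0 + κ = 0 := by
  obtain ⟨x, hx, hx0⟩ := Matrix.exists_mulVec_eq_zero_iff.mpr hdet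
  rw [hM'] at hx0
  have h1 : v ⬝ᵥ M *ᵥ x = κ * x 0 := by
    rw [Matrix.dotProduct_mulVec, ← Matrix.mulVec_transpose, hsymm, hv]
    simp
  have h2 := congrArg (fun z => v ⬝ᵥ z) hx0
  have h3 := congrArg (fun z => x ⬝ᵥ z) hx0
  simp only [dotProduct_add, dotProduct_single, dotProduct_zero, h1] at h2 h3
  have hx0' : x 0 ≠ 0 := fun h => by
    have := hM x hx
    rw [h] at h3
    linarith
  apply mul_right_cancel₀ hx0'
  linarith

/-! ### The linear system behind the numbers `η`. -/

theorem Ptilde_mulVec (n : ℕ) (y : Fin (n - 1) → ℝ) (r : Fin (n - 1)) :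
    (Ptilde n *ᵥ y) r = ∑ c : Fin (n - 1), (if (c : ℕ) = 0 then (if (r : ℕ) = 0 then -1 else 0)
      else 1 / (((r : ℝ) + c + 2) * ((r : ℝ) + c + 3))) * y c := rfl

/-- For a kernel vector with first coordinate set to zero, the quadratic form of the positive
definite matrix in `shifted_jacobi_pos` vanishes: the first row meets the zero coordinate, the other
rows agree with those of `Ptilde`. The first row of `Ptilde` then kills the coordinate that was
dropped. -/
theorem Δ_ne_zero (n : ℕ) : Δ n ≠ 0 := by
  intro h
  obtain ⟨y, hy, hPy⟩ := Matrix.exists_mulVec_eq_zero_iff.mpr h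
  set z : Fin (n - 1) → ℝ := fun c => if (c : ℕ) = 0 then 0 else y c with hz
  set M : Matrix (Fin (n - 1)) (Fin (n - 1)) ℝ :=
    Matrix.of fun i j => 1 / (((i : ℝ) + j + 2) * ((i : ℝ) + j + 3)) with hM
  have hrow : ∀ r : Fin (n - 1), (r : ℕ) ≠ 0 → (M *ᵥ z) r = 0 := fun r hr => by
    have h0 := congrFun hPy r
    rw [Ptilde_mulVec] at h0
    refine (Finset.sum_congr rfl fun c _ => ?_).trans h0
    by_cases hc : (c : ℕ) = 0 <;> simp [hz, hM, hc, hr]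
  have hz0 : z = 0 := by
    by_contra hne
    refine (shifted_jacobi_pos hne).ne' (Finset.sum_eq_zero fun r _ => ?_)
    by_cases hr : (r : ℕ) = 0
    · simp [hz, hr]
    · exact mul_eq_zero_of_right _ (hrow r hr)
  refine hy (funext fun c => ?_)
  by_cases hc : (c : ℕ) = 0
  · have h0 := congrFun hPy c
    rw [Ptilde_mulVec, Finset.sum_eq_single c] at h0
    · simpa [hc] using h0
    · intro b _ hb
      have hb0 : (b : ℕ) ≠ 0 := fun h => hb (Fin.ext (h.trans hc.symm))
      have := congrFun hz0 b
      simp only [hz, hb0, if_false, Pi.zero_apply] at this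
      simp [this]
    · simp
  · simpa [hz, hc] using congrFun hz0 c

theorem colDet_eq_cramer (n : ℕ) (v : Fin (n - 1) → ℝ) (j : Fin (n - 1)) :
    colDet n v (j + 1) = (Ptilde n).cramer v j := by
  rw [colDet, Matrix.cramer_apply]
  congr 1
  ext r c
  by_cases h : c = j
  · simp [h]
  · have : (c : ℕ) ≠ j := fun h' => h (Fin.ext h')
    simp [h, this]

theorem Ptilde_mulVec_η (n : ℕ) (an : ℝ) :
    Ptilde n *ᵥ (fun j => η n an (j + 1))
      = ((-1) ^ (n - 1) / ((n - 1)! : ℝ) * an) • d' n + d'' n := by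
  have h : (fun j : Fin (n - 1) => η n an (j + 1)) = (1 / Δ n) •
      (((-1) ^ (n - 1) / ((n - 1)! : ℝ) * an) • (Ptilde n).cramer (d' n)
        + (Ptilde n).cramer (d'' n)) := by
    ext j
    simp only [η, colDet_eq_cramer, Pi.smul_apply, Pi.add_apply, smul_eq_mul]
    ring
  have hΔ := Δ_ne_zero n
  rw [h, Matrix.mulVec_smul, Matrix.mulVec_add, Matrix.mulVec_smul, Matrix.mulVec_cramer,
    Matrix.mulVec_cramer, ← Δ, smul_comm _ (Δ n), ← smul_add, smul_smul, one_div_mul_cancel hΔ,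
    one_smul]

/-! ### Corner thresholds of the two matrices and the value of `ξ₀`. -/

/-- The matrix with entries `1 / ((i + j - 1) (i + j))`, indices counted from `1`. -/
noncomputable def jacobiMatrix (n : ℕ) : Matrix (Fin n) (Fin n) ℝ :=
  Matrix.of fun i j => 1 / (((i : ℝ) + j + 1) * ((i : ℝ) + j + 2))

/-- The Hilbert matrix. -/
noncomputable def hilbertMatrix (n : ℕ) : Matrix (Fin n) (Fin n) ℝ :=
  Matrix.of fun i j => 1 / ((i : ℝ) + j + 1)

theorem jacobiMatrix_transpose (n : ℕ) : (jacobiMatrix n)ᵀ = jacobiMatrix n := by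
  ext i j
  simp only [jacobiMatrix, Matrix.transpose_apply, Matrix.of_apply, add_comm (j : ℝ)]

theorem hilbertMatrix_transpose (n : ℕ) : (hilbertMatrix n)ᵀ = hilbertMatrix n := by
  ext i j
  simp only [hilbertMatrix, Matrix.transpose_apply, Matrix.of_apply, add_comm (j : ℝ)]

theorem jacobiMatrix_mulVec_jacobiCol (m : ℕ) :
    jacobiMatrix (m + 1) *ᵥ (fun j => jacobiCol m j) = Pi.single 0 (m ! : ℝ) := by
  ext i
  rw [Matrix.mulVec, dotProduct]
  simp only [jacobiMatrix, Matrix.of_apply]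
  rw [Fin.sum_univ_eq_sum_range
    (fun j => 1 / (((i : ℝ) + j + 1) * ((i : ℝ) + j + 2)) * jacobiCol m j)]
  by_cases hi : i = 0
  · subst hi
    simpa using jacobiCol_row_zero m
  · rw [Pi.single_eq_of_ne hi]
    exact jacobiCol_row (Nat.one_le_iff_ne_zero.mpr (Fin.val_ne_zero_iff.mpr hi)) (by omega)

theorem hilbertMatrix_mulVec_hilbertCol (m : ℕ) :
    hilbertMatrix (m + 1) *ᵥ (fun j => hilbertCol m j) = Pi.single 0 ((m ! : ℝ) / (m + 1)) := by
  ext i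
  rw [Matrix.mulVec, dotProduct]
  simp only [hilbertMatrix, Matrix.of_apply]
  rw [Fin.sum_univ_eq_sum_range (fun j => 1 / ((i : ℝ) + j + 1) * hilbertCol m j)]
  by_cases hi : i = 0
  · subst hi
    simpa using hilbertCol_row_zero m
  · rw [Pi.single_eq_of_ne hi]
    exact hilbertCol_row (Nat.one_le_iff_ne_zero.mpr (Fin.val_ne_zero_iff.mpr hi)) (by omega)

/-- The matrix `M` with its upper left entry replaced by `e`. -/
def withCorner {m : ℕ} (M : Matrix (Fin (m + 1)) (Fin (m + 1)) ℝ) (e : ℝ) :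
    Matrix (Fin (m + 1)) (Fin (m + 1)) ℝ :=
  Matrix.of fun i j => if (i : ℕ) = 0 ∧ (j : ℕ) = 0 then e else M i j

theorem withCorner_mulVec {m : ℕ} (M : Matrix (Fin (m + 1)) (Fin (m + 1)) ℝ) (e : ℝ)
    (x : Fin (m + 1) → ℝ) :
    withCorner M e *ᵥ x = M *ᵥ x + Pi.single 0 ((e - M 0 0) * x 0) := by
  ext i
  refine Fin.cases ?_ (fun i => ?_) i
  · have h : (M *ᵥ x) 0 = M 0 0 * x 0 + ∑ j : Fin m, M 0 j.succ * x j.succ :=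
      Fin.sum_univ_succ _
    rw [Pi.add_apply, h, Matrix.mulVec, dotProduct, Fin.sum_univ_succ]
    simp [withCorner]
    ring
  · simp [withCorner, Matrix.mulVec, dotProduct]

theorem withCorner_quadForm {m : ℕ} (M : Matrix (Fin (m + 1)) (Fin (m + 1)) ℝ) (e : ℝ)
    (x : Fin (m + 1) → ℝ) :
    x ⬝ᵥ withCorner M e *ᵥ x = x ⬝ᵥ M *ᵥ x + (e - M 0 0) * x 0 ^ 2 := by
  rw [withCorner_mulVec, dotProduct_add, dotProduct_single]
  ring

/-- The Hilbert matrix becomes singular exactly at corner value `1 - 1/n²`, with `n = m + 1`;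
solving for `ξ` gives the threshold of `withCorner_jacobiMatrix_pos`. -/
theorem root_eq {m : ℕ} {ξ : ℝ} (h : (rootMatrix (m + 1) ξ).det = 0) :
    ξ = 1 / 2 - 1 / (((m : ℝ) + 1) * (m + 2)) := by
  have hR : rootMatrix (m + 1) ξ = withCorner (hilbertMatrix (m + 1))
      ((1 + 1 / ((m + 1 : ℕ) : ℝ)) * ξ + 1 / 2 - 1 / (2 * ((m + 1 : ℕ) : ℝ))) := rfl
  have h1 := corner_eq_of_det_eq_zero (hilbertMatrix_transpose _) (fun x hx => hilbert_pos hx)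
    (hilbertMatrix_mulVec_hilbertCol m) (withCorner_mulVec _ _) (hR ▸ h)
  rw [Fin.val_zero, hilbertCol_zero, Nat.factorial_succ] at h1
  have hf : (m ! : ℝ) ≠ 0 := by positivity
  have hm : (m : ℝ) + 1 ≠ 0 := by positivity
  have hm2 : (m : ℝ) + 2 ≠ 0 := by positivity
  simp only [hilbertMatrix, Matrix.of_apply, Fin.val_zero, Nat.cast_zero] at h1
  push_cast at h1
  field_simp at h1 ⊢
  have h2 : ((m : ℝ) + 2) * (2 * (m + 1) * (m + 2) * ξ - ((m + 1) * (m + 2) - 2)) = 0 := by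
    apply mul_left_cancel₀ hf
    linear_combination ((m : ℝ) + 2) * h1
  have := (mul_eq_zero.mp h2).resolve_left hm2
  linarith

theorem withCorner_jacobiMatrix_pos {m : ℕ} {e : ℝ}
    (he : 1 / 2 - 1 / (((m : ℝ) + 1) * (m + 2)) < e) {x : Fin (m + 1) → ℝ} (hx : x ≠ 0) :
    0 < x ⬝ᵥ withCorner (jacobiMatrix (m + 1)) e *ᵥ x := by
  rw [withCorner_quadForm]
  refine quadForm_add_corner_pos (jacobiMatrix_transpose _) (fun x hx => jacobi_pos hx)
    (jacobiMatrix_mulVec_jacobiCol m) ?_ ?_ hx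
  · rw [Fin.val_zero, jacobiCol_zero]; positivity
  · rw [Fin.val_zero, jacobiCol_zero, Nat.factorial_succ, Nat.factorial_succ]
    have hf : (0 : ℝ) < m ! := by positivity
    have h1 : ((m : ℝ) + 1) * (m + 2) * (1 / 2 - 1 / (((m : ℝ) + 1) * (m + 2)))
        < ((m : ℝ) + 1) * (m + 2) * e := by gcongr
    have h2 : ((m : ℝ) + 1) * (m + 2) * (1 / 2 - 1 / (((m : ℝ) + 1) * (m + 2)))
        = ((m : ℝ) + 1) * (m + 2) / 2 - 1 := by field_simp
    have h3 : 0 < (m ! : ℝ) * (((m : ℝ) + 1) * (m + 2) * (e - 1 / 2) + 1) := by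
      apply mul_pos hf; linarith
    simp only [jacobiMatrix, Matrix.of_apply, Fin.val_zero, Nat.cast_zero]
    push_cast
    linarith

theorem withCorner_hilbertMatrix_pos {m : ℕ} {e : ℝ}
    (he : 1 - 1 / ((m : ℝ) + 1) ^ 2 < e) {x : Fin (m + 1) → ℝ} (hx : x ≠ 0) :
    0 < x ⬝ᵥ withCorner (hilbertMatrix (m + 1)) e *ᵥ x := by
  rw [withCorner_quadForm]
  refine quadForm_add_corner_pos (hilbertMatrix_transpose _) (fun x hx => hilbert_pos hx)
    (hilbertMatrix_mulVec_hilbertCol m) ?_ ?_ hx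
  · rw [Fin.val_zero, hilbertCol_zero]; positivity
  · rw [Fin.val_zero, hilbertCol_zero, Nat.factorial_succ]
    have hf : (0 : ℝ) < m ! := by positivity
    have h3 : 0 < (m ! : ℝ) * (m + 1) * (e - (1 - 1 / ((m : ℝ) + 1) ^ 2)) := by
      apply mul_pos (by positivity); linarith
    have h4 : (m ! : ℝ) * (m + 1) * (e - (1 - 1 / ((m : ℝ) + 1) ^ 2))
        = (m ! : ℝ) * (m + 1) * (e - 1) + m ! / (m + 1) := by field_simp; ring
    simp only [hilbertMatrix, Matrix.of_apply, Fin.val_zero, Nat.cast_zero]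
    push_cast
    linarith

/-! ### The image of the feedback vector under the corner matrix. -/

/-- The vector `a` in the scaling by `D_n`. -/
noncomputable def scaledVec (n : ℕ) (an : ℝ) : Fin n → ℝ :=
  fun i => (-1) ^ (i : ℕ) / ((i : ℕ)! : ℝ) * aVec n an i

theorem scaledVec_zero (k : ℕ) (an : ℝ) : scaledVec (k + 2) an 0 = a1 (k + 2) := by
  simp [scaledVec, aVec]

theorem scaledVec_last (k : ℕ) (an : ℝ) :
    scaledVec (k + 2) an (Fin.last (k + 1)) = (-1) ^ (k + 1) / ((k + 1)! : ℝ) * an := by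
  simp [scaledVec, aVec]

theorem scaledVec_mid (k : ℕ) (an : ℝ) (i : Fin k) :
    scaledVec (k + 2) an i.succ.castSucc = η (k + 2) an ((i : ℕ) + 2) := by
  have h1 : (i : ℕ) + 1 ≠ k + 1 := by omega
  have h2 : (-1 : ℝ) ^ ((i : ℕ) + 1) * (-1) ^ ((i : ℕ) + 1) = 1 := by rw [← mul_pow]; simp
  have h3 : (((i : ℕ) + 1)! : ℝ) ≠ 0 := by positivity
  simp only [scaledVec, aVec, Fin.val_castSucc, Fin.val_succ, Nat.add_one_ne_zero, if_false,
    show k + 2 - 1 = k + 1 from rfl, h1]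
  field_simp
  linear_combination η (k + 2) an ((i : ℕ) + 2) * h2

/-- These rows are the system of `Ptilde_mulVec_η`: the known end coordinates of the vector form its
right-hand side, and `η₁`, absent from the vector, enters through the required value, whence the
column `(-1, 0, …, 0)` of `Ptilde`. -/
theorem jacobiMatrix_mulVec_scaledVec_succ (k : ℕ) (an : ℝ) (r : Fin (k + 1)) :
    (jacobiMatrix (k + 2) *ᵥ scaledVec (k + 2) an) r.succ
      = if r = 0 then η (k + 2) an 1 - 1 / 2 else 0 := by
  have h := congrFun (Ptilde_mulVec_η (k + 2) an) r
  rw [Ptilde_mulVec] at h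
  have h' : ∀ f : Fin (k + 1) → ℝ, ∑ c : Fin (k + 2 - 1), f c = ∑ c : Fin (k + 1), f c :=
    fun _ => rfl
  rw [h', Fin.sum_univ_succ] at h
  simp only [Fin.val_zero, if_true, Fin.val_succ, Nat.add_one_ne_zero, if_false, Pi.add_apply,
    Pi.smul_apply, smul_eq_mul, d', d'', show k + 2 - 1 = k + 1 from rfl, zero_add] at h
  rw [Matrix.mulVec, dotProduct, Fin.sum_univ_castSucc, Fin.sum_univ_succ]
  simp only [jacobiMatrix, Matrix.of_apply, Fin.castSucc_zero, scaledVec_zero, scaledVec_mid,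
    scaledVec_last, Fin.val_zero, Fin.val_castSucc, Fin.val_succ, Fin.val_last]
  push_cast at h ⊢
  have hsum : ∑ i : Fin k, 1 / (((r : ℝ) + 1 + (i + 1) + 1) * ((r : ℝ) + 1 + (i + 1) + 2))
        * η (k + 2) an ((i : ℕ) + 2)
      = ∑ i : Fin k, 1 / (((r : ℝ) + (i + 1) + 2) * ((r : ℝ) + (i + 1) + 3))
        * η (k + 2) an ((i : ℕ) + 1 + 1) := by
    refine Finset.sum_congr rfl fun i _ => ?_
    congr 2
    ring
  have hd1 : 1 / (((r : ℝ) + 1 + (k + 1) + 1) * ((r : ℝ) + 1 + (k + 1) + 2))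
      = 1 / (((k : ℝ) + 2 + r + 1) * ((k : ℝ) + 2 + r + 2)) := by congr 1; ring
  rw [hsum, hd1]
  by_cases hr : r = 0
  · subst hr
    simp only [Fin.val_zero, if_true, Nat.cast_zero] at h ⊢
    linear_combination h
  · have hr' : (r : ℕ) ≠ 0 := Fin.val_ne_zero_iff.mpr hr
    simp only [hr', hr, if_false] at h ⊢
    have hd2 : a1 (k + 2) / (((r : ℝ) + 2) * ((r : ℝ) + 3))
      = 1 / (((r : ℝ) + 1 + 0 + 1) * ((r : ℝ) + 1 + 0 + 2)) * a1 (k + 2) := by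
      rw [div_eq_mul_one_div, mul_comm]; congr 2; ring
    linear_combination h + hd2

theorem withCorner_mulVec_scaledVec_succ (k : ℕ) (an : ℝ) (r : Fin (k + 1)) :
    (withCorner (jacobiMatrix (k + 2)) (η (k + 2) an 1) *ᵥ scaledVec (k + 2) an) r.succ
      = if r = 0 then η (k + 2) an 1 - 1 / 2 else 0 := by
  rw [withCorner_mulVec, Pi.add_apply, Pi.single_eq_of_ne (Fin.succ_ne_zero r), add_zero,
    jacobiMatrix_mulVec_scaledVec_succ]

/-- This row is not part of Cramer's system. Pairing with `jacobiCol` expresses it through the next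
row and `a₁`, the remaining rows being zero; `a₁ = -n(n+1)/2` makes the result `-η₁`. -/
theorem withCorner_mulVec_scaledVec_zero (k : ℕ) (an : ℝ) :
    (withCorner (jacobiMatrix (k + 2)) (η (k + 2) an 1) *ᵥ scaledVec (k + 2) an) 0
      = -η (k + 2) an 1 := by
  have h : (fun j : Fin (k + 2) => jacobiCol (k + 1) j) ⬝ᵥ
      (jacobiMatrix (k + 2) *ᵥ scaledVec (k + 2) an) = ((k + 1)! : ℝ) * a1 (k + 2) := by
    rw [Matrix.dotProduct_mulVec, ← Matrix.mulVec_transpose, jacobiMatrix_transpose,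
      jacobiMatrix_mulVec_jacobiCol, single_dotProduct, scaledVec_zero]
  rw [dotProduct, Fin.sum_univ_succ, Fin.sum_univ_succ, Finset.sum_eq_zero (fun i _ => by
    rw [jacobiMatrix_mulVec_scaledVec_succ, if_neg (Fin.succ_ne_zero i), mul_zero])] at h
  rw [jacobiMatrix_mulVec_scaledVec_succ, if_pos rfl] at h
  simp only [Fin.val_zero, Fin.val_succ, zero_add, jacobiCol_zero, jacobiCol_one,
    Nat.factorial_succ] at h
  rw [withCorner_mulVec, Pi.add_apply, Pi.single_eq_same, scaledVec_zero]
  simp only [jacobiMatrix, Matrix.of_apply, Fin.val_zero, Nat.cast_zero]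
  set Y := (jacobiMatrix (k + 2) *ᵥ scaledVec (k + 2) an) 0 with hY
  have hY' : (Matrix.of fun i j : Fin (k + 2) =>
      1 / (((i : ℝ) + j + 1) * ((i : ℝ) + j + 2))) *ᵥ scaledVec (k + 2) an
      = jacobiMatrix (k + 2) *ᵥ scaledVec (k + 2) an := rfl
  rw [hY', ← hY]
  have hf : (k ! : ℝ) ≠ 0 := by positivity
  have hk1 : (k : ℝ) + 1 ≠ 0 := by positivity
  have hk2 : (k : ℝ) + 2 ≠ 0 := by positivity
  have hk3 : (k : ℝ) + 3 ≠ 0 := by positivity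
  simp only [a1] at h ⊢
  push_cast at h ⊢
  have hc : (k ! : ℝ) * (k + 1) * (k + 2) * (k + 3) ≠ 0 := by positivity
  apply mul_left_cancel₀ hc
  linear_combination h

/-! ### Positivity and the Lyapunov equation for `F⁻¹`. -/

theorem Finv_apply (m : ℕ) (c an : ℝ) (i j : Fin (m + 1)) :
    Finv (m + 1) c an i j = (2 * ((m + 1 : ℕ) : ℝ) - 1) * (2 * ((m + 1 : ℕ) : ℝ)) * c *
      ((-1) ^ (i : ℕ) / ((i : ℕ)! : ℝ) *
        withCorner (jacobiMatrix (m + 1)) (η (m + 1) an 1) i j *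
        ((-1) ^ (j : ℕ) / ((j : ℕ)! : ℝ))) := by
  rw [Finv, Dn, Matrix.mul_diagonal, Matrix.diagonal_mul]
  simp only [C, withCorner, jacobiMatrix, Matrix.smul_apply, Matrix.of_apply, smul_eq_mul]
  ring

theorem withCorner_jacobiMatrix_comm (m : ℕ) (e : ℝ) (i j : Fin (m + 1)) :
    withCorner (jacobiMatrix (m + 1)) e i j = withCorner (jacobiMatrix (m + 1)) e j i := by
  simp only [withCorner, jacobiMatrix, Matrix.of_apply, and_comm (a := (i : ℕ) = 0),
    add_comm (i : ℝ)]

theorem Finv_transpose (m : ℕ) (c an : ℝ) : (Finv (m + 1) c an)ᵀ = Finv (m + 1) c an := by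
  ext i j
  rw [Matrix.transpose_apply, Finv_apply, Finv_apply, withCorner_jacobiMatrix_comm]
  ring

/-- Multiplication of the `k`-th coordinate by `k`, counted from `1`. -/
def weight (n : ℕ) : Matrix (Fin n) (Fin n) ℝ := Matrix.diagonal fun i => (i : ℝ) + 1

theorem Finv_pos {m : ℕ} {c an : ℝ} (hc : 0 < c)
    (he : 1 / 2 - 1 / (((m : ℝ) + 1) * (m + 2)) < η (m + 1) an 1) {y : Fin (m + 1) → ℝ}
    (hy : y ≠ 0) : 0 < y ⬝ᵥ Finv (m + 1) c an *ᵥ y := by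
  set x : Fin (m + 1) → ℝ := fun i => (-1) ^ (i : ℕ) / ((i : ℕ)! : ℝ) * y i with hx
  have hx0 : x ≠ 0 := fun h => hy (funext fun i => by
    have := congrFun h i
    have hf : ((i : ℕ)! : ℝ) ≠ 0 := by positivity
    simpa [hx, hf] using this)
  have h := withCorner_jacobiMatrix_pos he hx0
  have hs : 0 < (2 * ((m + 1 : ℕ) : ℝ) - 1) * (2 * ((m + 1 : ℕ) : ℝ)) * c := by
    push_cast
    have : 0 < 2 * ((m : ℝ) + 1) - 1 := by linarith [(Nat.cast_nonneg m : (0 : ℝ) ≤ m)]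
    positivity
  have hmul := mul_pos hs h
  suffices hsum : y ⬝ᵥ Finv (m + 1) c an *ᵥ y
      = (2 * ((m + 1 : ℕ) : ℝ) - 1) * (2 * ((m + 1 : ℕ) : ℝ)) * c *
        (x ⬝ᵥ withCorner (jacobiMatrix (m + 1)) (η (m + 1) an 1) *ᵥ x) from hsum ▸ hmul
  simp only [dotProduct, Matrix.mulVec, Finset.mul_sum, Finv_apply]
  refine Finset.sum_congr rfl fun i _ => Finset.sum_congr rfl fun j _ => ?_
  simp only [hx]
  ring

/-- Symmetrization multiplies each entry by the sum of its indices, which cancels one factor of the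
denominator and leaves a Hilbert matrix with corner `2 η₁`. -/
theorem weight_Finv_pos {m : ℕ} {c an : ℝ} (hc : 0 < c)
    (he : 1 - 1 / ((m : ℝ) + 1) ^ 2 < 2 * η (m + 1) an 1) {y : Fin (m + 1) → ℝ}
    (hy : y ≠ 0) : 0 < y ⬝ᵥ (weight (m + 1) * Finv (m + 1) c an) *ᵥ y := by
  set x : Fin (m + 1) → ℝ := fun i => (-1) ^ (i : ℕ) / ((i : ℕ)! : ℝ) * y i with hx
  have hx0 : x ≠ 0 := fun h => hy (funext fun i => by
    have := congrFun h i
    have hf : ((i : ℕ)! : ℝ) ≠ 0 := by positivity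
    simpa [hx, hf] using this)
  have h := withCorner_hilbertMatrix_pos he hx0
  have hs : 0 < (2 * ((m + 1 : ℕ) : ℝ) - 1) * (2 * ((m + 1 : ℕ) : ℝ)) * c := by
    push_cast
    have : 0 < 2 * ((m : ℝ) + 1) - 1 := by linarith [(Nat.cast_nonneg m : (0 : ℝ) ≤ m)]
    positivity
  suffices hsum : 2 * (y ⬝ᵥ (weight (m + 1) * Finv (m + 1) c an) *ᵥ y)
      = (2 * ((m + 1 : ℕ) : ℝ) - 1) * (2 * ((m + 1 : ℕ) : ℝ)) * c *
        (x ⬝ᵥ withCorner (hilbertMatrix (m + 1)) (2 * η (m + 1) an 1) *ᵥ x) by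
    have := mul_pos hs h
    linarith
  have h1 : y ⬝ᵥ (weight (m + 1) * Finv (m + 1) c an) *ᵥ y
      = ∑ i : Fin (m + 1), ∑ j : Fin (m + 1), ((i : ℝ) + 1) * (y i * Finv (m + 1) c an i j * y j) := by
    simp only [dotProduct, Matrix.mulVec, Finset.mul_sum, weight, Matrix.diagonal_mul]
    refine Finset.sum_congr rfl fun i _ => Finset.sum_congr rfl fun j _ => ?_
    ring
  have h2 : y ⬝ᵥ (weight (m + 1) * Finv (m + 1) c an) *ᵥ y
      = ∑ i : Fin (m + 1), ∑ j : Fin (m + 1), ((j : ℝ) + 1) * (y i * Finv (m + 1) c an i j * y j) := by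
    rw [h1, Finset.sum_comm]
    refine Finset.sum_congr rfl fun i _ => Finset.sum_congr rfl fun j _ => ?_
    have hs := congrFun (congrFun (Finv_transpose m c an) i) j
    rw [Matrix.transpose_apply] at hs
    rw [hs]
    ring
  rw [two_mul]
  nth_rewrite 1 [h1]
  rw [h2, ← Finset.sum_add_distrib]
  simp only [← Finset.sum_add_distrib]
  simp only [dotProduct, Matrix.mulVec, Finset.mul_sum, Finv_apply]
  refine Finset.sum_congr rfl fun i _ => Finset.sum_congr rfl fun j _ => ?_
  have hent : ((i : ℝ) + j + 2) * withCorner (jacobiMatrix (m + 1)) (η (m + 1) an 1) i j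
      = withCorner (hilbertMatrix (m + 1)) (2 * η (m + 1) an 1) i j := by
    simp only [withCorner, jacobiMatrix, hilbertMatrix, Matrix.of_apply]
    split_ifs with hij
    · rw [hij.1, hij.2]; simp
    · have : (i : ℝ) + j + 1 ≠ 0 := by positivity
      have : (i : ℝ) + j + 2 ≠ 0 := by positivity
      field_simp
  rw [← hent]
  simp only [hx]
  ring

theorem A0_mul_apply_zero {m : ℕ} (G : Matrix (Fin (m + 1)) (Fin (m + 1)) ℝ) (j : Fin (m + 1)) :
    (A0 (m + 1) * G) 0 j = 0 := by
  simp [A0, Matrix.mul_apply]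

theorem A0_mul_apply_succ {m : ℕ} (G : Matrix (Fin (m + 1)) (Fin (m + 1)) ℝ) (i : Fin m)
    (j : Fin (m + 1)) : (A0 (m + 1) * G) i.succ j = G i.castSucc j := by
  rw [Matrix.mul_apply, Finset.sum_eq_single i.castSucc]
  · simp [A0]
  · intro b _ hb
    have : (i : ℕ) ≠ b := fun h => hb (Fin.ext h.symm)
    simp [A0, this]
  · simp

theorem Finv_mulVec_aVec (k : ℕ) (c an : ℝ) (i : Fin (k + 2)) :
    (Finv (k + 2) c an *ᵥ aVec (k + 2) an) i
      = (2 * ((k + 2 : ℕ) : ℝ) - 1) * (2 * ((k + 2 : ℕ) : ℝ)) * c *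
      ((-1) ^ (i : ℕ) / ((i : ℕ)! : ℝ) *
        (withCorner (jacobiMatrix (k + 2)) (η (k + 2) an 1) *ᵥ scaledVec (k + 2) an) i) := by
  simp only [Matrix.mulVec, dotProduct, Finv_apply, Finset.mul_sum, scaledVec]
  refine Finset.sum_congr rfl fun j _ => ?_
  ring

theorem neg_one_pow_div_factorial_succ (i : ℕ) :
    (-1 : ℝ) ^ i / (i ! : ℝ) = -((i : ℝ) + 1) * ((-1) ^ (i + 1) / ((i + 1)! : ℝ)) := by
  have : (i ! : ℝ) ≠ 0 := by positivity
  have : (i : ℝ) + 1 ≠ 0 := by positivity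
  rw [Nat.factorial_succ, pow_succ]
  push_cast
  field_simp

/-- The matrix Lyapunov equation `(A₀ + b₀ a*) F⁻¹ + F⁻¹ (A₀ + b₀ a*)* = -(N F⁻¹ + F⁻¹ N)`. -/
theorem lyapunov_Finv (k : ℕ) (c an : ℝ) (i j : Fin (k + 2)) :
    (A0 (k + 2) * Finv (k + 2) c an
        + Matrix.vecMulVec (b0 (k + 2)) (Finv (k + 2) c an *ᵥ aVec (k + 2) an)
        + weight (k + 2) * Finv (k + 2) c an) i j
      = -(A0 (k + 2) * Finv (k + 2) c an
        + Matrix.vecMulVec (b0 (k + 2)) (Finv (k + 2) c an *ᵥ aVec (k + 2) an)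
        + weight (k + 2) * Finv (k + 2) c an) j i := by
  have hcol : ∀ j : Fin (k + 1),
      (A0 (k + 2) * Finv (k + 2) c an
        + Matrix.vecMulVec (b0 (k + 2)) (Finv (k + 2) c an *ᵥ aVec (k + 2) an)
        + weight (k + 2) * Finv (k + 2) c an) 0 j.succ
      = -(A0 (k + 2) * Finv (k + 2) c an
        + Matrix.vecMulVec (b0 (k + 2)) (Finv (k + 2) c an *ᵥ aVec (k + 2) an)
        + weight (k + 2) * Finv (k + 2) c an) j.succ 0 := by
    intro j
    simp only [Matrix.add_apply, A0_mul_apply_zero, A0_mul_apply_succ, Matrix.vecMulVec_apply,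
      weight, Matrix.diagonal_mul, Finv_mulVec_aVec, withCorner_mulVec_scaledVec_succ, Finv_apply,
      b0, Fin.val_zero, Fin.val_succ, Nat.add_one_ne_zero, if_true, if_false]
    -- Only the first of these entries involves the corner `η₁`; it is balanced by the value `η₁ -
    -- 1/2`, the others by the zeros of the transformed vector.
    refine Fin.cases ?_ (fun l => ?_) j
    · simp [withCorner, jacobiMatrix]
      ring
    · have h1 : (l : ℝ) + 2 ≠ 0 := by positivity
      have h2 : (l : ℝ) + 3 ≠ 0 := by positivity
      have h3 : (l : ℝ) + 1 + 1 + 1 ≠ 0 := by positivity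
      have h4 : (l : ℝ) + 1 + 1 + 2 ≠ 0 := by positivity
      simp only [withCorner, jacobiMatrix, Matrix.of_apply, Fin.succ_ne_zero, if_false,
        Fin.val_succ, Fin.val_castSucc, Fin.val_zero, Nat.add_one_ne_zero, and_false, false_and,
        neg_one_pow_div_factorial_succ ((l : ℕ) + 1)]
      push_cast
      field_simp
      ring
  refine Fin.cases ?_ (fun i => ?_) i <;> refine Fin.cases ?_ (fun j => ?_) j
  · simp only [Matrix.add_apply, A0_mul_apply_zero, Matrix.vecMulVec_apply,
      weight, Matrix.diagonal_mul, Finv_mulVec_aVec, withCorner_mulVec_scaledVec_zero, Finv_apply,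
      b0, Fin.val_zero]
    simp [withCorner]
    ring
  · exact hcol j
  · rw [hcol i, neg_neg]
  -- Away from the first row and column neither `a` nor `η₁` occurs: this is an identity between the
  -- fractions.
  · have h1 : (i : ℝ) + j + 2 ≠ 0 := by positivity
    have h2 : (i : ℝ) + j + 3 ≠ 0 := by positivity
    have h3 : (i : ℝ) + j + 4 ≠ 0 := by positivity
    simp only [Matrix.add_apply, A0_mul_apply_succ, Matrix.vecMulVec_apply,
      weight, Matrix.diagonal_mul, Finv_apply, withCorner, jacobiMatrix, Matrix.of_apply,
      b0, Fin.val_succ, Fin.val_castSucc, Nat.add_one_ne_zero, and_false, if_false,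
      neg_one_pow_div_factorial_succ (i : ℕ), neg_one_pow_div_factorial_succ (j : ℕ)]
    push_cast
    rw [show (i : ℝ) + (j + 1) + 1 = i + j + 2 by ring,
      show (j : ℝ) + (i + 1) + 1 = i + j + 2 by ring,
      show (i : ℝ) + (j + 1) + 2 = i + j + 3 by ring,
      show (j : ℝ) + (i + 1) + 2 = i + j + 3 by ring,
      show (i : ℝ) + 1 + (j + 1) + 1 = i + j + 3 by ring,
      show (j : ℝ) + 1 + (i + 1) + 1 = i + j + 3 by ring,
      show (i : ℝ) + 1 + (j + 1) + 2 = i + j + 4 by ring,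
      show (j : ℝ) + 1 + (i + 1) + 2 = i + j + 4 by ring]
    field_simp
    ring

/-! ### Admissible data. -/

/-- The conditions on `F`, its inverse `G` and the feedback vector `a` under which the equation
`2 a₀ θ = (D(θ) F D(θ) x, x)` defines a controllability function with derivative `-1`. -/
structure IsAdmissible {n : ℕ} (F G : Matrix (Fin n) (Fin n) ℝ) (a : Fin n → ℝ) : Prop where
  symm : Fᵀ = F
  mul_eq_one : F * G = 1
  pos : ∀ z, z ≠ 0 → 0 < z ⬝ᵥ F *ᵥ z
  weight_pos : ∀ z, z ≠ 0 → 0 < (F *ᵥ z) ⬝ᵥ (weight n *ᵥ z)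
  lyapunov : ∀ z, (F *ᵥ z) ⬝ᵥ (A0 n *ᵥ z + (a ⬝ᵥ z) • b0 n) = -((F *ᵥ z) ⬝ᵥ (weight n *ᵥ z))

theorem dotProduct_mulVec_comm_of_symm {n : ℕ} {M : Matrix (Fin n) (Fin n) ℝ} (hM : Mᵀ = M)
    (x y : Fin n → ℝ) : x ⬝ᵥ M *ᵥ y = y ⬝ᵥ M *ᵥ x := by
  rw [Matrix.dotProduct_mulVec, ← Matrix.mulVec_transpose, hM, dotProduct_comm]

theorem dotProduct_self_eq_zero_of_antisymm {n : ℕ} {S : Matrix (Fin n) (Fin n) ℝ}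
    (hS : ∀ i j, S i j = -S j i) (y : Fin n → ℝ) : y ⬝ᵥ S *ᵥ y = 0 := by
  have h : Sᵀ = -S := by ext i j; simpa using hS j i
  have h2 : y ⬝ᵥ S *ᵥ y = -(y ⬝ᵥ S *ᵥ y) := by
    conv_lhs =>
      rw [Matrix.dotProduct_mulVec, ← Matrix.mulVec_transpose, h, dotProduct_comm,
        Matrix.neg_mulVec, dotProduct_neg]
  linarith

/-- Each condition on `F` at `z` is the condition on `G` at `y = F z`; antisymmetry makes the
Lyapunov form vanish there. -/
theorem isAdmissible_of_inverse {n : ℕ} {F G : Matrix (Fin n) (Fin n) ℝ} {a : Fin n → ℝ}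
    (hFG : F = G⁻¹) (hG : Gᵀ = G) (hpos : ∀ y, y ≠ 0 → 0 < y ⬝ᵥ G *ᵥ y)
    (hweight : ∀ y, y ≠ 0 → 0 < y ⬝ᵥ (weight n * G) *ᵥ y)
    (hlyap : ∀ i j, (A0 n * G + Matrix.vecMulVec (b0 n) (G *ᵥ a) + weight n * G) i j
      = -(A0 n * G + Matrix.vecMulVec (b0 n) (G *ᵥ a) + weight n * G) j i) :
    IsAdmissible F G a := by
  have hdet : IsUnit G.det := by
    rw [isUnit_iff_ne_zero]
    intro h
    obtain ⟨y, hy, hGy⟩ := Matrix.exists_mulVec_eq_zero_iff.mpr h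
    have := hpos y hy
    simp [hGy] at this
  have hmul : F * G = 1 := by rw [hFG, Matrix.nonsing_inv_mul _ hdet]
  have hmul' : G * F = 1 := by rw [hFG, Matrix.mul_nonsing_inv _ hdet]
  have hGF : ∀ z, G *ᵥ F *ᵥ z = z := fun z => by
    rw [Matrix.mulVec_mulVec, hmul', Matrix.one_mulVec]
  have hne : ∀ z, z ≠ 0 → F *ᵥ z ≠ 0 := fun z hz h => hz (by rw [← hGF z, h, Matrix.mulVec_zero])
  refine ⟨?_, hmul, fun z hz => ?_, fun z hz => ?_, fun z => ?_⟩
  · rw [hFG, Matrix.transpose_nonsing_inv, hG]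
  · have := hpos _ (hne z hz)
    rwa [hGF, dotProduct_comm] at this
  · have := hweight _ (hne z hz)
    rwa [← Matrix.mulVec_mulVec, hGF] at this
  · have h := dotProduct_self_eq_zero_of_antisymm hlyap (F *ᵥ z)
    have h1 : (G *ᵥ a) ⬝ᵥ (F *ᵥ z) = a ⬝ᵥ z := by
      rw [dotProduct_comm, dotProduct_mulVec_comm_of_symm hG, hGF]
    rw [Matrix.add_mulVec, Matrix.add_mulVec, ← Matrix.mulVec_mulVec, ← Matrix.mulVec_mulVec,
      hGF, Matrix.vecMulVec_mulVec, h1, dotProduct_add] at h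
    rw [← op_smul_eq_smul]
    linarith

/-! ### Dilations and the normalized equation. -/

/-- The point with coordinates `s ^ k x_k`, `k = 1, …, n`. -/
def scaled {n : ℕ} (x : Fin n → ℝ) (s : ℝ) : Fin n → ℝ := fun i => s ^ ((i : ℕ) + 1) * x i

theorem scaled_scaled_inv {n : ℕ} (x : Fin n → ℝ) {s : ℝ} (hs : s ≠ 0) :
    scaled (scaled x s) s⁻¹ = x := by
  ext i
  simp only [scaled]
  rw [← mul_assoc, ← mul_pow, inv_mul_cancel₀ hs, one_pow, one_mul]

theorem scaled_zero_right {n : ℕ} (x : Fin n → ℝ) : scaled x 0 = 0 := by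
  ext i
  simp [scaled]

theorem scaled_zero_left {n : ℕ} (s : ℝ) : scaled (0 : Fin n → ℝ) s = 0 := by
  ext i
  simp [scaled]

theorem scaled_ne_zero {n : ℕ} {x : Fin n → ℝ} (hx : x ≠ 0) {s : ℝ} (hs : s ≠ 0) :
    scaled x s ≠ 0 := fun h => hx (by
  rw [← scaled_scaled_inv x hs, h, scaled_zero_left])

theorem thetaEq_iff {n : ℕ} (F : Matrix (Fin n) (Fin n) ℝ) (a₀ : ℝ) (x : Fin n → ℝ) {θ : ℝ}
    (hθ : 0 < θ) : ThetaEq F a₀ x θ ↔ scaled x θ⁻¹ ⬝ᵥ F *ᵥ scaled x θ⁻¹ = 2 * a₀ := by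
  have hD : ∀ i : Fin n, θ ^ (-((2 * ((i : ℝ) + 1) - 1) / 2))
      = θ ^ (1 / 2 : ℝ) * θ⁻¹ ^ ((i : ℕ) + 1) := fun i => by
    rw [inv_pow, ← Real.rpow_natCast, ← Real.rpow_neg hθ.le, ← Real.rpow_add hθ]
    congr 1
    push_cast
    ring
  have hsq : θ ^ (1 / 2 : ℝ) * θ ^ (1 / 2 : ℝ) = θ := by
    rw [← Real.rpow_add hθ]; norm_num
  have h : ((D n θ * F * D n θ) *ᵥ x) ⬝ᵥ x
      = θ * (scaled x θ⁻¹ ⬝ᵥ F *ᵥ scaled x θ⁻¹) := by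
    simp only [dotProduct, Matrix.mulVec, D, Matrix.mul_diagonal, Matrix.diagonal_mul, hD,
      Finset.mul_sum, Finset.sum_mul, scaled]
    refine Finset.sum_congr rfl fun i _ => Finset.sum_congr rfl fun j _ => ?_
    linear_combination
      θ⁻¹ ^ ((i : ℕ) + 1) * θ⁻¹ ^ ((j : ℕ) + 1) * F i j * x i * x j * hsq
  rw [ThetaEq, h]
  constructor
  · intro h'
    apply mul_left_cancel₀ hθ.ne'
    linarith
  · intro h'
    rw [h']
    ring

theorem feedback_eq {n : ℕ} (a : Fin n → ℝ) (Θ : (Fin n → ℝ) → ℝ) {x : Fin n → ℝ} (hx : x ≠ 0) :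
    feedback a Θ x = a ⬝ᵥ scaled x (Θ x)⁻¹ := by
  rw [feedback, if_neg hx]
  refine Finset.sum_congr rfl fun i _ => ?_
  simp only [scaled, inv_pow]
  ring

/-- The chain raises the index by one and `b₀` has weight one, so the dilation passes through at the
cost of a single factor `s`. -/
theorem scaled_closedLoop {n : ℕ} (u : (Fin n → ℝ) → ℝ) (x : Fin n → ℝ) (s : ℝ) :
    scaled (closedLoop u x) s = s • (A0 n *ᵥ scaled x s + u x • b0 n) := by
  ext i
  simp only [closedLoop, scaled, Pi.add_apply, Pi.smul_apply, smul_eq_mul, Matrix.mulVec,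
    dotProduct, A0, Matrix.of_apply, b0, mul_add, Finset.mul_sum]
  congr 1
  · refine Finset.sum_congr rfl fun j _ => ?_
    split_ifs with h
    · rw [h]; ring
    · ring
  · split_ifs with h
    · rw [h]; ring
    · ring

theorem hasDerivAt_quadForm {n : ℕ} {F : Matrix (Fin n) (Fin n) ℝ} (hF : Fᵀ = F)
    {z : ℝ → Fin n → ℝ} {z' : Fin n → ℝ} {t : ℝ} (hz : HasDerivAt z z' t) :
    HasDerivAt (fun s => z s ⬝ᵥ F *ᵥ z s) (2 * ((F *ᵥ z t) ⬝ᵥ z')) t := by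
  have hz' := hasDerivAt_pi.mp hz
  have hFz : ∀ i, HasDerivAt (fun s => (F *ᵥ z s) i) ((F *ᵥ z') i) t := fun i =>
    HasDerivAt.fun_sum (u := Finset.univ) fun j _ => (hz' j).const_mul (F i j)
  have h := HasDerivAt.fun_sum (u := Finset.univ) fun i _ => (hz' i).mul (hFz i)
  refine h.congr_deriv ?_
  rw [Finset.sum_add_distrib]
  have h1 : ∑ i, z' i * (F *ᵥ z t) i = (F *ᵥ z t) ⬝ᵥ z' := dotProduct_comm _ _
  have h2 : ∑ i, z t i * (F *ᵥ z') i = (F *ᵥ z t) ⬝ᵥ z' := by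
    rw [dotProduct_comm (F *ᵥ z t)]
    exact dotProduct_mulVec_comm_of_symm hF _ _
  rw [h1, h2]
  ring

theorem hasDerivAt_scaled {n : ℕ} {x : ℝ → Fin n → ℝ} {x' : Fin n → ℝ} {s : ℝ → ℝ} {s' t : ℝ}
    (hx : HasDerivAt x x' t) (hs : HasDerivAt s s' t) (hst : s t ≠ 0) :
    HasDerivAt (fun r => scaled (x r) (s r))
      (scaled x' (s t) + (s' / s t) • (weight n *ᵥ scaled (x t) (s t))) t := by
  rw [hasDerivAt_pi] at hx ⊢
  intro i
  refine ((hs.pow ((i : ℕ) + 1)).mul (hx i)).congr_deriv ?_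
  simp only [weight, Matrix.mulVec_diagonal, Pi.add_apply, Pi.smul_apply, smul_eq_mul, scaled]
  simp
  field_simp
  ring

theorem contDiff_quadForm_scaled {n : ℕ} (F : Matrix (Fin n) (Fin n) ℝ) :
    ContDiff ℝ 1 fun p : (Fin n → ℝ) × ℝ => scaled p.1 p.2 ⬝ᵥ F *ᵥ scaled p.1 p.2 := by
  simp only [scaled, dotProduct, Matrix.mulVec]
  fun_prop

theorem continuous_quadForm_scaled_left {n : ℕ} (F : Matrix (Fin n) (Fin n) ℝ) (s : ℝ) :
    Continuous fun x : Fin n → ℝ => scaled x s ⬝ᵥ F *ᵥ scaled x s :=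
  (contDiff_quadForm_scaled F).continuous.comp (by fun_prop : Continuous fun x => (x, s))

theorem continuous_quadForm_scaled_right {n : ℕ} (F : Matrix (Fin n) (Fin n) ℝ) (x : Fin n → ℝ) :
    Continuous fun s => scaled x s ⬝ᵥ F *ᵥ scaled x s :=
  (contDiff_quadForm_scaled F).continuous.comp (by fun_prop : Continuous fun s => (x, s))

/-! ### The controllability function and its derivative. -/

namespace IsAdmissible

variable {n : ℕ} {F G : Matrix (Fin n) (Fin n) ℝ} {a : Fin n → ℝ}

theorem dotProduct_sq_le (h : IsAdmissible F G a) (v z : Fin n → ℝ) :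
    (v ⬝ᵥ z) ^ 2 ≤ (v ⬝ᵥ G *ᵥ v) * (z ⬝ᵥ F *ᵥ z) ∧ 0 ≤ v ⬝ᵥ G *ᵥ v := by
  by_cases hv : v = 0
  · simp [hv]
  have hFG : F *ᵥ G *ᵥ v = v := by rw [Matrix.mulVec_mulVec, h.mul_eq_one, Matrix.one_mulVec]
  have hGv : G *ᵥ v ≠ 0 := fun h0 => hv (by rw [← hFG, h0, Matrix.mulVec_zero])
  have hq : 0 < v ⬝ᵥ G *ᵥ v := by
    have := h.pos _ hGv
    rwa [hFG, dotProduct_comm] at this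
  refine ⟨?_, hq.le⟩
  set q := v ⬝ᵥ G *ᵥ v with hqdef
  set p := v ⬝ᵥ z with hpdef
  have hnonneg : ∀ y, 0 ≤ y ⬝ᵥ F *ᵥ y := fun y => by
    by_cases hy : y = 0
    · simp [hy]
    · exact (h.pos y hy).le
  have h1 := hnonneg (q • z - p • G *ᵥ v)
  have h2 : (G *ᵥ v) ⬝ᵥ F *ᵥ z = p := by
    rw [dotProduct_mulVec_comm_of_symm h.symm, hFG, dotProduct_comm]
  have h3 : z ⬝ᵥ v = p := dotProduct_comm _ _
  have h4 : (G *ᵥ v) ⬝ᵥ v = q := dotProduct_comm _ _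
  simp only [Matrix.mulVec_sub, Matrix.mulVec_smul, dotProduct_sub, sub_dotProduct,
    smul_dotProduct, dotProduct_smul, smul_eq_mul, hFG, h2, h3, h4] at h1
  have h5 : 0 ≤ q * (q * (z ⬝ᵥ F *ᵥ z) - p ^ 2) := by linarith
  linarith [nonneg_of_mul_nonneg_right h5 hq]

theorem hasDerivAt_quadForm_scaled (h : IsAdmissible F G a) (x : Fin n → ℝ) {s : ℝ}
    (hs : s ≠ 0) :
    HasDerivAt (fun s => scaled x s ⬝ᵥ F *ᵥ scaled x s)
      (2 / s * ((F *ᵥ scaled x s) ⬝ᵥ (weight n *ᵥ scaled x s))) s := by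
  have h1 := hasDerivAt_quadForm h.symm
    (hasDerivAt_scaled (hasDerivAt_const s x) (hasDerivAt_id s) hs)
  refine h1.congr_deriv ?_
  simp only [scaled_zero_left, zero_add, dotProduct_smul, smul_eq_mul, id]
  ring

theorem strictMonoOn_quadForm_scaled (h : IsAdmissible F G a) {x : Fin n → ℝ} (hx : x ≠ 0) :
    StrictMonoOn (fun s => scaled x s ⬝ᵥ F *ᵥ scaled x s) (Set.Ici 0) := by
  refine strictMonoOn_of_deriv_pos (convex_Ici 0)
    (continuous_quadForm_scaled_right F x).continuousOn fun s hs => ?_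
  rw [interior_Ici, Set.mem_Ioi] at hs
  rw [(h.hasDerivAt_quadForm_scaled x hs.ne').deriv]
  have := h.weight_pos _ (scaled_ne_zero hx hs.ne')
  positivity

theorem exists_quadForm_scaled_eq (h : IsAdmissible F G a) {c : ℝ} (hc : 0 < c)
    {x : Fin n → ℝ} (hx : x ≠ 0) : ∃ s, 0 < s ∧ scaled x s ⬝ᵥ F *ᵥ scaled x s = c := by
  obtain ⟨k, hk⟩ := Function.ne_iff.mp hx
  have hk2 : 0 < x k ^ 2 := by have : x k ≠ 0 := hk; positivity
  set v : Fin n → ℝ := Pi.single k 1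
  set β := v ⬝ᵥ G *ᵥ v
  have hβ : 0 ≤ β := (h.dotProduct_sq_le v 0).2
  -- Cauchy–Schwarz against the `k`-th basis vector bounds `β` times the form below by `s * x k ^
  -- 2`, and this `s` makes that exceed `β * c`.
  set s := 1 + β * c / x k ^ 2 with hs
  have hs1 : 1 ≤ s := by
    have : 0 ≤ β * c / x k ^ 2 := by positivity
    linarith
  have hlarge : c ≤ scaled x s ⬝ᵥ F *ᵥ scaled x s := by
    have h1 := (h.dotProduct_sq_le v (scaled x s)).1
    have h2 : v ⬝ᵥ scaled x s = s ^ ((k : ℕ) + 1) * x k := by simp [v, scaled]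
    have h3 : s ≤ s ^ ((k : ℕ) + 1) := le_self_pow₀ hs1 (by omega)
    have h4 : s ≤ (s ^ ((k : ℕ) + 1)) ^ 2 := by nlinarith
    have h5 : s * x k ^ 2 = x k ^ 2 + β * c := by rw [hs, add_mul, one_mul, div_mul_cancel₀ _ hk2.ne']
    rw [h2, mul_pow] at h1
    have h6 : s * x k ^ 2 ≤ (s ^ ((k : ℕ) + 1)) ^ 2 * x k ^ 2 := by gcongr
    exact (lt_of_mul_lt_mul_left (by linarith : β * c < β * _) hβ).le
  obtain ⟨t, ht, hct⟩ := intermediate_value_Icc (zero_le_one.trans hs1)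
    (continuous_quadForm_scaled_right F x).continuousOn
    (show c ∈ Set.Icc _ _ from ⟨by simp [scaled_zero_right, hc.le], hlarge⟩)
  refine ⟨t, lt_of_le_of_ne ht.1 fun h0 => ?_, hct⟩
  rw [← h0] at hct
  simp only [scaled_zero_right, zero_dotProduct] at hct
  exact hc.ne hct

theorem existsUnique_thetaEq (h : IsAdmissible F G a) {a₀ : ℝ} (ha₀ : 0 < a₀)
    {x : Fin n → ℝ} (hx : x ≠ 0) : ∃! θ : ℝ, 0 < θ ∧ ThetaEq F a₀ x θ := by
  obtain ⟨s, hs, hsx⟩ := h.exists_quadForm_scaled_eq (by positivity : 0 < 2 * a₀) hx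
  refine ⟨s⁻¹, ⟨inv_pos.mpr hs, (thetaEq_iff F a₀ x (inv_pos.mpr hs)).mpr (by rwa [inv_inv])⟩,
    fun θ ⟨hθ, hθx⟩ => ?_⟩
  rw [thetaEq_iff F a₀ x hθ] at hθx
  have := (h.strictMonoOn_quadForm_scaled hx).injOn (inv_pos.mpr hθ).le hs.le
    (hθx.trans hsx.symm)
  rw [← this, inv_inv]

variable {a₀ : ℝ} {Θ : (Fin n → ℝ) → ℝ}

theorem lt_iff (h : IsAdmissible F G a) (ha₀ : 0 < a₀) (hΘ : IsControllabilityFunction F a₀ Θ)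
    (x : Fin n → ℝ) {θ : ℝ} (hθ : 0 < θ) :
    (Θ x < θ ↔ scaled x θ⁻¹ ⬝ᵥ F *ᵥ scaled x θ⁻¹ < 2 * a₀) ∧
    (θ < Θ x ↔ 2 * a₀ < scaled x θ⁻¹ ⬝ᵥ F *ᵥ scaled x θ⁻¹) := by
  by_cases hx : x = 0
  · subst hx
    rw [hΘ.1, scaled_zero_left]
    simp [hθ, ha₀, hθ.not_gt, ha₀.le]
  · obtain ⟨hpos, heq⟩ := hΘ.2 x hx
    rw [thetaEq_iff F a₀ x hpos] at heq
    have hmono := h.strictMonoOn_quadForm_scaled hx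
    rw [← heq]
    exact ⟨(inv_lt_inv₀ hθ hpos).symm.trans
        (hmono.lt_iff_lt (inv_pos.mpr hθ).le (inv_pos.mpr hpos).le).symm,
      (inv_lt_inv₀ hpos hθ).symm.trans
        (hmono.lt_iff_lt (inv_pos.mpr hpos).le (inv_pos.mpr hθ).le).symm⟩

theorem _root_.ChainSynthesis.IsControllabilityFunction.nonneg
    (hΘ : IsControllabilityFunction F a₀ Θ) (x : Fin n → ℝ) : 0 ≤ Θ x := by
  by_cases hx : x = 0
  · rw [hx, hΘ.1]
  · exact (hΘ.2 x hx).1.le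

theorem _root_.ChainSynthesis.IsControllabilityFunction.eq_zero_iff
    (hΘ : IsControllabilityFunction F a₀ Θ) (x : Fin n → ℝ) : x = 0 ↔ Θ x = 0 :=
  ⟨fun h => by rw [h, hΘ.1], fun h => by
    by_contra hx
    exact (hΘ.2 x hx).1.ne' h⟩

theorem continuous (h : IsAdmissible F G a) (ha₀ : 0 < a₀)
    (hΘ : IsControllabilityFunction F a₀ Θ) : Continuous Θ := by
  refine continuous_iff_continuousAt.mpr fun x => tendsto_order.mpr ⟨fun r hr => ?_, fun r hr => ?_⟩
  · by_cases hx : x = 0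
    · rw [hx, hΘ.1] at hr
      exact Filter.Eventually.of_forall fun y => hr.trans_le (hΘ.nonneg y)
    · have hpos := (hΘ.2 x hx).1
      -- The comparison `lt_iff` needs a positive level, and `r` may be negative.
      set r' := max r (Θ x / 2)
      have hr' : 0 < r' := lt_max_of_lt_right (by positivity)
      have hlt : r' < Θ x := max_lt hr (by linarith)
      rw [(h.lt_iff ha₀ hΘ x hr').2] at hlt
      filter_upwards [(continuous_quadForm_scaled_left F r'⁻¹).continuousAt.eventually
        (lt_mem_nhds hlt)] with y hy
      exact (le_max_left _ _).trans_lt ((h.lt_iff ha₀ hΘ y hr').2.mpr hy)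
  · have hr' : 0 < r := (hΘ.nonneg x).trans_lt hr
    have hlt := (h.lt_iff ha₀ hΘ x hr').1.mp hr
    filter_upwards [(continuous_quadForm_scaled_left F r⁻¹).continuousAt.eventually
      (gt_mem_nhds hlt)] with y hy
    exact (h.lt_iff ha₀ hΘ y hr').1.mpr hy

/-- The implicit function theorem is applied to `s = 1/Θ`, in which the equation is polynomial;
continuity of `Θ` identifies `1/Θ` with the local implicit function. -/
theorem contDiffAt (h : IsAdmissible F G a) (ha₀ : 0 < a₀)
    (hΘ : IsControllabilityFunction F a₀ Θ) {x : Fin n → ℝ} (hx : x ≠ 0) :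
    ContDiffAt ℝ 1 Θ x := by
  set f : (Fin n → ℝ) × ℝ → ℝ := fun p => scaled p.1 p.2 ⬝ᵥ F *ᵥ scaled p.1 p.2 with hf
  set u : (Fin n → ℝ) × ℝ := (x, (Θ x)⁻¹) with hu
  have hfu : ∀ y, y ≠ 0 → f (y, (Θ y)⁻¹) = 2 * a₀ := fun y hy =>
    (thetaEq_iff F a₀ y (hΘ.2 y hy).1).mp (hΘ.2 y hy).2
  have cdf : ContDiffAt ℝ 1 f u := (contDiff_quadForm_scaled F).contDiffAt
  have hs : 0 < (Θ x)⁻¹ := inv_pos.mpr (hΘ.2 x hx).1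
  have hderiv : 0 < (fderiv ℝ f u) (0, 1) := by
    have h1 : HasDerivAt (fun s : ℝ => (x, s)) ((0 : Fin n → ℝ), (1 : ℝ)) (Θ x)⁻¹ :=
      (hasDerivAt_const _ x).prodMk (hasDerivAt_id _)
    have h2 := (cdf.differentiableAt one_ne_zero).hasFDerivAt.comp_hasDerivAt (Θ x)⁻¹ h1
    rw [h2.unique (h.hasDerivAt_quadForm_scaled x hs.ne')]
    have := h.weight_pos _ (scaled_ne_zero hx hs.ne')
    positivity
  have hinv : (fderiv ℝ f u ∘L .inr ℝ (Fin n → ℝ) ℝ).IsInvertible :=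
    ⟨ContinuousLinearEquiv.unitsEquivAut ℝ (Units.mk0 _ hderiv.ne'), by ext; simp⟩
  have hcont : Filter.Tendsto (fun y => (y, (Θ y)⁻¹)) (nhds x) (nhds u) :=
    Filter.Tendsto.prodMk_nhds Filter.tendsto_id
      ((h.continuous ha₀ hΘ).continuousAt.inv₀ (hΘ.2 x hx).1.ne')
  have hev : (fun y => (Θ y)⁻¹) =ᶠ[nhds x] cdf.implicitFunction one_ne_zero hinv := by
    filter_upwards [hcont.eventually (cdf.eventually_apply_eq_iff_implicitFunction one_ne_zero hinv),
      isOpen_ne.mem_nhds hx] with y hy hy0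
    exact (hy.mp ((hfu y hy0).trans (hfu x hx).symm)).symm
  have hinvC : ContDiffAt ℝ 1 (fun y => (Θ y)⁻¹) x :=
    (cdf.contDiffAt_implicitFunction one_ne_zero hinv).congr_of_eventuallyEq hev
  exact (hinvC.inv hs.ne').congr_of_eventuallyEq (by simp [Pi.inv_def])

theorem fderiv_closedLoop (h : IsAdmissible F G a) (ha₀ : 0 < a₀)
    (hΘ : IsControllabilityFunction F a₀ Θ) {x : Fin n → ℝ} (hx : x ≠ 0) :
    fderiv ℝ Θ x (closedLoop (feedback a Θ) x) = -1 := by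
  set v := closedLoop (feedback a Θ) x with hv
  set p := fderiv ℝ Θ x v with hp
  have hpos := (hΘ.2 x hx).1
  set s := (Θ x)⁻¹ with hs
  have hs0 : 0 < s := inv_pos.mpr hpos
  have hcurve : HasDerivAt (fun t : ℝ => x + t • v) v 0 := by
    simpa using ((hasDerivAt_id (0 : ℝ)).smul_const v).const_add x
  have hx0 : x + (0 : ℝ) • v = x := by simp
  have hΘd : HasDerivAt (fun t : ℝ => Θ (x + t • v)) p 0 := by
    have h1 : HasFDerivAt Θ (fderiv ℝ Θ x) (x + (0 : ℝ) • v) := by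
      rw [hx0]
      exact ((h.contDiffAt ha₀ hΘ hx).differentiableAt one_ne_zero).hasFDerivAt
    exact h1.comp_hasDerivAt 0 hcurve
  have hsd := hΘd.inv (by rw [hx0]; exact hpos.ne')
  have hz := hasDerivAt_quadForm h.symm (hasDerivAt_scaled hcurve hsd
    (by simpa using hpos.ne'))
  have hconst : (fun t : ℝ => scaled (x + t • v) (Θ (x + t • v))⁻¹ ⬝ᵥ
      F *ᵥ scaled (x + t • v) (Θ (x + t • v))⁻¹) =ᶠ[nhds 0] fun _ => 2 * a₀ := by
    have : ∀ᶠ t in nhds (0 : ℝ), x + t • v ≠ 0 :=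
      hcurve.continuousAt.eventually (isOpen_ne.mem_nhds (by simpa using hx))
    filter_upwards [this] with t ht
    exact (thetaEq_iff F a₀ _ (hΘ.2 _ ht).1).mp (hΘ.2 _ ht).2
  have hzero := hz.unique ((hasDerivAt_const (0 : ℝ) (2 * a₀)).congr_of_eventuallyEq hconst)
  simp only [Pi.inv_apply, hx0, ← hs] at hzero
  rw [hv, scaled_closedLoop, feedback_eq a Θ hx, ← hs, dotProduct_add, dotProduct_smul,
    dotProduct_smul, h.lyapunov] at hzero
  have hw := h.weight_pos _ (scaled_ne_zero hx hs0.ne')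
  set w := (F *ᵥ scaled x s) ⬝ᵥ (weight n *ᵥ scaled x s)
  have hΘs : Θ x = s⁻¹ := by rw [hs, inv_inv]
  rw [hΘs] at hzero
  simp only [smul_eq_mul] at hzero
  field_simp at hzero
  have h3 : w * (p + 1) = 0 := by
    apply mul_left_cancel₀ (by positivity : 2 * s ≠ 0)
    linear_combination -hzero
  rcases mul_eq_zero.mp h3 with h4 | h4
  · exact absurd h4 hw.ne'
  · linarith

theorem abs_feedback_le (h : IsAdmissible F G a) (hΘ : IsControllabilityFunction F a₀ Θ)
    {d : ℝ} (hd : 0 < d) (ha₀d : a₀ ≤ d ^ 2 / (2 * ((G *ᵥ a) ⬝ᵥ a))) (x : Fin n → ℝ) :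
    |feedback a Θ x| ≤ d := by
  by_cases hx : x = 0
  · simp [feedback, hx, hd.le]
  obtain ⟨hpos, heq⟩ := hΘ.2 x hx
  rw [thetaEq_iff F a₀ x hpos] at heq
  rw [feedback_eq a Θ hx]
  obtain ⟨h1, h2⟩ := h.dotProduct_sq_le a (scaled x (Θ x)⁻¹)
  rw [heq] at h1
  rw [dotProduct_comm] at ha₀d
  refine abs_le_of_sq_le_sq (h1.trans ?_) hd.le
  rcases h2.eq_or_lt with h0 | h0
  · rw [← h0, zero_mul]
    positivity
  · rw [le_div_iff₀ (by positivity)] at ha₀d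
    linarith

end IsAdmissible

/-! ### Behaviour and existence of trajectories. -/

theorem eq_max_of_hasDerivWithinAt_neg_one {f : ℝ → ℝ} {T : ℝ}
    (hc : ContinuousOn f (Set.Icc 0 T)) (h0 : ∀ t ∈ Set.Icc 0 T, 0 ≤ f t)
    (hd : ∀ t ∈ Set.Ico 0 T, 0 < f t → HasDerivWithinAt f (-1) (Set.Icc 0 T) t) :
    ∀ t ∈ Set.Icc 0 T, f t = max (f 0 - t) 0 := by
  have hslope : ∀ r s, 0 ≤ r → r ≤ s → s ≤ T → (∀ t ∈ Set.Ioo r s, 0 < f t) →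
      f s = f r - (s - r) := by
    intro r s hr hrs hsT hpos
    rcases hrs.eq_or_lt with rfl | hlt
    · simp
    obtain ⟨b, hb, hb'⟩ := exists_hasDerivAt_eq_slope f (fun _ => -1) hlt
      (hc.mono (Set.Icc_subset_Icc hr hsT)) fun t ht =>
        (hd t ⟨hr.trans ht.1.le, ht.2.trans_le hsT⟩ (hpos t ht)).hasDerivAt
          (Icc_mem_nhds (hr.trans_lt ht.1) (ht.2.trans_le hsT))
    rw [eq_div_iff (sub_pos.mpr hlt).ne'] at hb'
    linarith
  intro t ht
  have hcomp : IsCompact (Set.Icc 0 t ∩ f ⁻¹' {0}) :=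
    isCompact_Icc.of_isClosed_subset
      ((hc.mono (Set.Icc_subset_Icc le_rfl ht.2)).preimage_isClosed_of_isClosed isClosed_Icc
        isClosed_singleton) Set.inter_subset_left
  have hIcc : ∀ s ∈ Set.Icc 0 t, s ∈ Set.Icc 0 T := fun s hs => ⟨hs.1, hs.2.trans ht.2⟩
  rcases (h0 t ht).eq_or_lt with hft | hft
  -- Up to its first zero `r` the function has slope `-1`, so `f 0 = r ≤ t`.
  · obtain ⟨r, hr, hmin⟩ := hcomp.exists_isLeast ⟨t, ⟨ht.1, le_rfl⟩, hft.symm⟩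
    have h := hslope 0 r le_rfl hr.1.1 (hr.1.2.trans ht.2) fun s hs => by
      have hs' : s ∈ Set.Icc 0 t := ⟨hs.1.le, hs.2.le.trans hr.1.2⟩
      refine (h0 s (hIcc s hs')).lt_of_ne fun hs0 => ?_
      exact absurd (hmin ⟨hs', hs0.symm⟩) (not_le.mpr hs.2)
    rw [show f r = 0 from hr.2] at h
    rw [← hft, max_eq_right]
    linarith [hr.1.2]
  · have hne : ∀ s ∈ Set.Icc 0 t, 0 < f s := by
      by_contra! hneg
      obtain ⟨s, hs, hs0⟩ := hneg
      -- After its last zero `r` the function would decrease, so it cannot be positive at `t`: once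
      -- zero, it stays zero.
      obtain ⟨r, hr, hmax⟩ := hcomp.exists_isGreatest
        ⟨s, hs, le_antisymm hs0 (h0 s (hIcc s hs))⟩
      have h := hslope r t hr.1.1 hr.1.2 ht.2 fun q hq => by
        have hq' : q ∈ Set.Icc 0 t := ⟨hr.1.1.trans hq.1.le, hq.2.le⟩
        refine (h0 q (hIcc q hq')).lt_of_ne fun hq0 => ?_
        exact absurd (hmax ⟨hq', hq0.symm⟩) (not_le.mpr hq.1)
      rw [show f r = 0 from hr.2] at h
      linarith [hr.1.2]
    have h := hslope 0 t le_rfl ht.1 ht.2 fun s hs => hne s ⟨hs.1.le, hs.2.le⟩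
    rw [max_eq_left] <;> linarith

theorem exists_linear_flow {n : ℕ} (M : Matrix (Fin n) (Fin n) ℝ) (z₀ : Fin n → ℝ) :
    ∃ Z : ℝ → Fin n → ℝ, Z 0 = z₀ ∧ ∀ σ, HasDerivAt Z (M *ᵥ Z σ) σ := by
  set L : (Fin n → ℝ) →L[ℝ] (Fin n → ℝ) := (Matrix.toLin' M).toContinuousLinearMap with hL
  refine ⟨fun σ => NormedSpace.exp (σ • L) z₀, by simp, fun σ => ?_⟩
  have h := (hasDerivAt_exp_smul_const' L σ).clm_apply (hasDerivAt_const σ z₀)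
  refine h.congr_deriv ?_
  simp [hL]

namespace IsAdmissible

variable {n : ℕ} {F G : Matrix (Fin n) (Fin n) ℝ} {a : Fin n → ℝ} {a₀ : ℝ}
  {Θ : (Fin n → ℝ) → ℝ}

theorem eq_max_of_isTrajectory (h : IsAdmissible F G a) (ha₀ : 0 < a₀)
    (hΘ : IsControllabilityFunction F a₀ Θ) {x₀ : Fin n → ℝ} {T : ℝ} {x : ℝ → Fin n → ℝ}
    (hx : IsTrajectory (feedback a Θ) x₀ T x) {t : ℝ} (ht : t ∈ Set.Icc 0 T) :
    Θ (x t) = max (Θ x₀ - t) 0 := by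
  rw [← hx.init]
  refine eq_max_of_hasDerivWithinAt_neg_one (f := fun t => Θ (x t))
    ((h.continuous ha₀ hΘ).comp_continuousOn hx.cont) (fun t _ => hΘ.nonneg _)
    (fun t ht hpos => ?_) t ht
  have hne : x t ≠ 0 := fun h0 => hpos.ne' ((hΘ.eq_zero_iff _).mp h0)
  have hd := ((h.contDiffAt ha₀ hΘ hne).differentiableAt one_ne_zero).hasFDerivAt
  have := hd.comp_hasDerivWithinAt t (hx.ode t ht)
  rwa [h.fderiv_closedLoop ha₀ hΘ hne] at this

theorem exists_isTrajectory (h : IsAdmissible F G a) (ha₀ : 0 < a₀)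
    (hΘ : IsControllabilityFunction F a₀ Θ) (x₀ : Fin n → ℝ) :
    ∃ x : ℝ → Fin n → ℝ, IsTrajectory (feedback a Θ) x₀ (Θ x₀) x := by
  by_cases hx₀ : x₀ = 0
  · refine ⟨fun _ => 0, hx₀.symm, continuousOn_const, fun t ht => ?_⟩
    rw [hx₀, hΘ.1] at ht
    exact absurd (ht.1.trans_lt ht.2) (lt_irrefl _)
  obtain ⟨hpos, heq⟩ := hΘ.2 x₀ hx₀
  rw [thetaEq_iff F a₀ x₀ hpos] at heq
  set θ := Θ x₀ with hθ
  obtain ⟨Z, hZ0, hZ⟩ := exists_linear_flow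
    (A0 n + Matrix.vecMulVec (b0 n) a + weight n) (scaled x₀ θ⁻¹)
  have hM : ∀ σ, (A0 n + Matrix.vecMulVec (b0 n) a + weight n) *ᵥ Z σ
      = A0 n *ᵥ Z σ + (a ⬝ᵥ Z σ) • b0 n + weight n *ᵥ Z σ := fun σ => by
    rw [Matrix.add_mulVec, Matrix.add_mulVec, Matrix.vecMulVec_mulVec, op_smul_eq_smul]
  have hquad : ∀ σ, Z σ ⬝ᵥ F *ᵥ Z σ = 2 * a₀ := by
    have hd : ∀ σ, HasDerivAt (fun σ => Z σ ⬝ᵥ F *ᵥ Z σ) 0 σ := fun σ => by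
      refine (hasDerivAt_quadForm h.symm (hZ σ)).congr_deriv ?_
      rw [hM, dotProduct_add, h.lyapunov]
      ring
    intro σ
    rw [is_const_of_deriv_eq_zero (fun σ => (hd σ).differentiableAt) (fun σ => (hd σ).deriv) σ 0,
      hZ0, heq]
  -- With `Θ = θ - t` imposed and `σ = log (θ / (θ - t))`, the normalized point satisfies the linear
  -- equation of `Z`; the `weight` term compensates the shrinking dilation.
  set x : ℝ → Fin n → ℝ := fun t => scaled (Z (Real.log θ - Real.log (θ - t))) (θ - t) with hx
  have hderiv : ∀ t, t < θ → HasDerivAt x (closedLoop (feedback a Θ) (x t)) t := by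
    intro t ht
    have hτ : 0 < θ - t := sub_pos.mpr ht
    set σ := Real.log θ - Real.log (θ - t) with hσ
    have hZne : Z σ ≠ 0 := fun h0 => by
      have := hquad σ
      rw [h0] at this
      simp only [zero_dotProduct] at this
      linarith
    have hxt : x t = scaled (Z σ) (θ - t) := rfl
    have hxne : x t ≠ 0 := hxt ▸ scaled_ne_zero hZne hτ.ne'
    have hΘx : Θ (x t) = θ - t := by
      refine (h.existsUnique_thetaEq ha₀ hxne).unique (hΘ.2 _ hxne) ⟨hτ, ?_⟩
      rw [thetaEq_iff F a₀ _ hτ, hxt, scaled_scaled_inv _ hτ.ne', hquad]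
    have hloop : closedLoop (feedback a Θ) (x t)
        = scaled ((θ - t)⁻¹ • (A0 n *ᵥ Z σ + (a ⬝ᵥ Z σ) • b0 n)) (θ - t) := by
      have h1 := scaled_closedLoop (feedback a Θ) (x t) (θ - t)⁻¹
      rw [feedback_eq a Θ hxne, hΘx, hxt, scaled_scaled_inv _ hτ.ne', ← hxt] at h1
      rw [← h1]
      have := scaled_scaled_inv (closedLoop (feedback a Θ) (x t)) (inv_ne_zero hτ.ne')
      rw [inv_inv] at this
      exact this.symm
    have hτd : HasDerivAt (fun t => θ - t) (-1) t := by
      simpa using (hasDerivAt_id t).const_sub θ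
    have hσd : HasDerivAt (fun t => Real.log θ - Real.log (θ - t)) (θ - t)⁻¹ t := by
      refine ((hτd.log hτ.ne').const_sub _).congr_deriv ?_
      rw [neg_div, neg_neg, one_div]
    have hZd : HasDerivAt (fun t => Z (Real.log θ - Real.log (θ - t)))
        ((θ - t)⁻¹ • ((A0 n + Matrix.vecMulVec (b0 n) a + weight n) *ᵥ Z σ)) t :=
      (hZ σ).scomp t hσd
    refine (hasDerivAt_scaled hZd hτd hτ.ne').congr_deriv ?_
    rw [hloop, hM, ← hσ]
    ext i
    simp only [weight, Matrix.mulVec_diagonal, Pi.add_apply, Pi.smul_apply, smul_eq_mul, scaled]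
    field_simp
    ring
  refine ⟨x, ?_, fun t ht => ?_, fun t ht => (hderiv t ht.2).hasDerivWithinAt⟩
  · have := scaled_scaled_inv x₀ (inv_ne_zero hpos.ne')
    rw [inv_inv] at this
    simp only [hx, sub_zero, sub_self, hZ0, this]
  rcases ht.2.eq_or_lt with rfl | hlt
  -- At the final time `σ` tends to infinity, but `Z` stays on a bounded ellipsoid while the
  -- dilation factor tends to zero.
  · rw [ContinuousWithinAt, tendsto_pi_nhds]
    intro i
    have hxi : x θ i = 0 := by simp [hx, scaled]
    rw [hxi]
    set v : Fin n → ℝ := Pi.single i 1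
    set β := Real.sqrt ((v ⬝ᵥ G *ᵥ v) * (2 * a₀))
    have hZi : ∀ σ, |Z σ i| ≤ β := fun σ => by
      have h1 := (h.dotProduct_sq_le v (Z σ)).1
      rw [hquad, show v ⬝ᵥ Z σ = Z σ i by simp [v]] at h1
      exact Real.abs_le_sqrt h1
    refine squeeze_zero_norm' (a := fun t => |θ - t| ^ ((i : ℕ) + 1) * β)
      (Filter.Eventually.of_forall fun t => ?_) ?_
    · simp only [hx, scaled, Real.norm_eq_abs, abs_mul, abs_pow]
      gcongr
      exact hZi _
    · have hcont : Continuous fun t => |θ - t| ^ ((i : ℕ) + 1) * β := by fun_prop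
      have := hcont.continuousWithinAt (s := Set.Icc 0 θ) (x := θ)
      simpa [ContinuousWithinAt] using this
  · exact (hderiv t hlt).continuousAt.continuousWithinAt

end IsAdmissible

/-! ### Admissibility of the given data and the conclusion. -/

theorem isAdmissible_F {n : ℕ} (hn : 2 ≤ n) {c an ξ₀ : ℝ} (hξ₀ : (rootMatrix n ξ₀).det = 0)
    (hc : 0 < c)
    (han : max ξ₀ ((1 / 2 + 1 / (2 * (n : ℝ))) * ξ₀ + 1 / 4 - 1 / (4 * (n : ℝ))) < η n an 1) :
    IsAdmissible (F n c an) (Finv n c an) (aVec n an) := by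
  obtain ⟨k, rfl⟩ := Nat.exists_eq_add_of_le' hn
  have hξ := root_eq (m := k + 1) hξ₀
  have h1 := (le_max_left _ _).trans_lt han
  have h2 := (le_max_right _ _).trans_lt han
  refine isAdmissible_of_inverse ?_ (Finv_transpose (k + 1) c an)
    (fun y hy => Finv_pos hc (by rwa [← hξ]) hy)
    (fun y hy => weight_Finv_pos hc ?_ hy) (lyapunov_Finv k c an)
  · rw [F, Finv, Matrix.mul_inv_rev, Matrix.mul_inv_rev, Matrix.mul_assoc]
  -- Twice the second lower bound on `η₁` is the corner of `rootMatrix` at `ξ₀`, that is, the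
  -- Hilbert threshold `1 - 1/n²`.
  · have h3 : 1 - 1 / (((k + 1 : ℕ) : ℝ) + 1) ^ 2
        = 2 * ((1 / 2 + 1 / (2 * ((k + 2 : ℕ) : ℝ))) * ξ₀ + 1 / 4
          - 1 / (4 * ((k + 2 : ℕ) : ℝ))) := by
      rw [hξ]
      have : (k : ℝ) + 1 + 1 ≠ 0 := by positivity
      have : (k : ℝ) + 1 + 2 ≠ 0 := by positivity
      have : (k : ℝ) + 2 ≠ 0 := by positivity
      push_cast
      field_simp
      ring
    rw [h3]
    exact mul_lt_mul_of_pos_left h2 two_pos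

end ChainSynthesis

theorem theorem1 (n : ℕ) (hn : 2 ≤ n) (d : ℝ) (hd : 0 < d)
    (c an ξ₀ a₀ : ℝ)
    (hξ₀ : (rootMatrix n ξ₀).det = 0)
    (hc : 0 < c)
    (han : max ξ₀ ((1 / 2 + 1 / (2 * (n : ℝ))) * ξ₀ + 1 / 4 - 1 / (4 * (n : ℝ))) < η n an 1)
    (ha₀ : 0 < a₀)
    (ha₀d : a₀ ≤ d ^ 2 / (2 * ((Finv n c an *ᵥ aVec n an) ⬝ᵥ aVec n an))) :
    -- the function `Θ` is well defined
    (∀ x : Fin n → ℝ, x ≠ 0 → ∃! θ : ℝ, 0 < θ ∧ ThetaEq (F n c an) a₀ x θ) ∧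
    ∀ Θ : (Fin n → ℝ) → ℝ, IsControllabilityFunction (F n c an) a₀ Θ →
      Continuous Θ ∧
      ContDiffOn ℝ 1 Θ {0}ᶜ ∧
      -- the restriction on the control
      (∀ x, |feedback (aVec n an) Θ x| ≤ d) ∧
      -- the derivative of `Θ` by virtue of the closed-loop system
      (∀ x, x ≠ 0 → fderiv ℝ Θ x (closedLoop (feedback (aVec n an) Θ) x) = -1) ∧
      -- every point is steered to the origin in time exactly `Θ x₀`
      ∀ x₀ : Fin n → ℝ,
        (∃ x : ℝ → Fin n → ℝ,
          IsTrajectory (feedback (aVec n an) Θ) x₀ (Θ x₀) x) ∧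
        ∀ (T : ℝ) (x : ℝ → Fin n → ℝ),
          IsTrajectory (feedback (aVec n an) Θ) x₀ T x →
          ∀ t ∈ Set.Icc 0 T, Θ (x t) = max (Θ x₀ - t) 0 ∧ (x t = 0 ↔ Θ x₀ ≤ t) := by
  have h := isAdmissible_F hn hξ₀ hc han
  refine ⟨fun x hx => h.existsUnique_thetaEq ha₀ hx, fun Θ hΘ => ⟨h.continuous ha₀ hΘ,
    fun x hx => (h.contDiffAt ha₀ hΘ hx).contDiffWithinAt, h.abs_feedback_le hΘ hd ha₀d,
    fun x hx => h.fderiv_closedLoop ha₀ hΘ hx, fun x₀ => ⟨h.exists_isTrajectory ha₀ hΘ x₀,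
    fun T x hx t ht => ?_⟩⟩⟩
  have hmax := h.eq_max_of_isTrajectory ha₀ hΘ hx ht
  exact ⟨hmax, by rw [hΘ.eq_zero_iff, hmax, max_eq_right_iff, sub_nonpos]⟩
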